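/- Let $F:\mathbb R\to\mathbb C$ be even, with restriction to $(-\infty,0]$ of class $C^\infty$ (one-sided derivatives at $0$; no smoothness across $0$ is assumed) and such that $|t|^mF^{(n)}(t)\to0$ as $t\to-\infty$ for all integers $m,n\ge0$. Let $\widehat F(x)=\int_{\mathbb R}F(u)e^{-ixu}\,du=2\int_0^\infty F(u)\cos(xu)\,du$, let $r_n=\#\{(a,b)\in\mathbb Z^2:\ a^2+b^2=n\}$, and let $J_0(x)=\sum_{k\ge0}\frac{(-1)^k}{(k!)^2}\left(\frac x2\right)^{2k}$ be the Bessel function. Integrals $\int_0^\infty \sin(\alpha/u)\,\widehat F(u)\,\frac{du}{u}$ are understood as $\lim_{\varepsilon\to0^+}\int_\varepsilon^\infty$, where the integral over $(\varepsilon,\infty)$ is absolutely convergent. Then $F$ is integrable and the following hold. (a) (Circle formula in sine form) For every $y>0$, the improper integrals below exist for all $n\ge1$, both series converge absolutely, and $$\sum_{n=0}^{\infty} r_nF(ny)=\frac{\pi}{y}\int_0^\infty F(u)\,du+\frac1y\sum_{n=1}^\infty r_n\int_0^\infty\sin\left(\frac{\pi^2n}{yu}\right)\widehat F(u)\,\frac{du}{u}.$$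 (b) (Plancherel identity) For every $\alpha>0$, the function $x\mapsto J_0(2\sqrt{\alpha x})F(x)$ is integrable on $(0,\infty)$, the improper integral on the left below exists, and $$\int_0^\infty\sin\left(\frac{\alpha}{u}\right)\widehat F(u)\,\frac{du}{u}=\pi\int_0^\infty J_0\left(2\sqrt{\alpha x}\right)F(x)\,dx .$$ (c) (Classical circle, or Hardy–Landau, formula) For every $y>0$, the series below converge absolutely and $$F(0)+\sum_{n=1}^\infty r_nF(ny)=\frac{\pi}{y}\int_0^\infty F(x)\,dx+\frac{\pi}{y}\sum_{n=1}^\infty r_n\int_0^\infty J_0\left(2\pi\sqrt{nx/y}\right)F(x)\,dx ;$$ in particular, for $y=1$, $$F(0)+\sum_{n=1}^\infty r_nF(n)=\pi\int_0^\infty F(x)\,dx+\pi\sum_{n=1}^\infty r_n\int_0^\infty J_0\left(2\pi\sqrt{nx}\right)F(x)\,dx .$$ -/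

import Mathlib

open Real Set Filter Topology MeasureTheory
open scoped ContDiff

/-- `F : ℝ → ℂ` is the even extension to `ℝ` of a function in the Schwartz space of the closed
half-line `(-∞, 0]`: it is even, its restriction to `(-∞, 0]` is `C^∞` (with one-sided derivatives
at `0`), and `|t|^m F^{(n)}(t) → 0` as `t → -∞` for all `m, n`. No smoothness across `0` is
required. -/
structure IsEvenHalfLineSchwartz (F : ℝ → ℂ) : Prop where
  even : ∀ t : ℝ, F (-t) = F t
  smooth : ContDiffOn ℝ ∞ F (Iic 0)
  decay : ∀ m n : ℕ,
    Tendsto (fun t : ℝ => |t| ^ m * ‖iteratedDerivWithin n F (Iic 0) t‖) atBot (𝓝 0)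

/-- The number of `(a, b) ∈ ℤ²` with `a² + b² = n`. -/
noncomputable def sumTwoSquaresCount (n : ℕ) : ℕ :=
  {p : ℤ × ℤ | p.1 ^ 2 + p.2 ^ 2 = (n : ℤ)}.ncard

/-- The Fourier transform `F̂(x) = ∫_ℝ F(u) e^{-ixu} du`. -/
noncomputable def fourierHat (F : ℝ → ℂ) (x : ℝ) : ℂ :=
  ∫ u : ℝ, F u * Complex.exp (-(Complex.I * (x : ℂ) * (u : ℂ)))

/-- The Bessel function `J₀`, through its everywhere convergent power series. -/
noncomputable def besselJZero (x : ℝ) : ℝ :=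
  ∑' k : ℕ, (-1 : ℝ) ^ k / ((k.factorial : ℝ) ^ 2) * (x / 2) ^ (2 * k)

/-- `∫_0^∞ f(u) du` exists and equals `I`, as an integral that is absolutely convergent on every
`(ε, ∞)` with `ε > 0` and improper at `0`. -/
def HasImproperIntegralAtZero (f : ℝ → ℂ) (I : ℂ) : Prop :=
  (∀ ε : ℝ, 0 < ε → IntegrableOn f (Ioi ε)) ∧
    Tendsto (fun ε : ℝ => ∫ u in Ioi ε, f u) (𝓝[>] 0) (𝓝 I)

/-! ### The Bessel function `J₀` -/

/-! The circle formula is Poisson summation on ℤ² for the radial function (u, v) ↦ F(y(u² + v²)),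
which sees only the half-line on which F is regular. Grouping lattice points by a² + b² = n gives
the weights r_n. In polar coordinates the plane Fourier transform becomes (π/y) ∫ J₀(2π√(nx/y)) F(x)
dx (`planeFourier_radial`), and the frequency 0 gives the main term.

Convergence on the dual side comes from the equation (x Y')' = -s Y of Y(x) = J₀(2√(sx)).
Integrating by parts moves the operator f ↦ (x f')' onto F, and its factor x kills the boundary
terms at 0 whatever the one-sided derivatives of F are there. Two rounds give decay s⁻²
(`exists_sq_mul_norm_integral_le`), enough for summability over ℤ².

For the Plancherel identity, Fubini on (ε, ∞) reduces the claim to ∫_ε^∞ sin(α/u) cos(xu) du/u. With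
u = √(α/x) eᵗ and z = 2√(αx), the integrand becomes ½(sin(z cosh t) - sin(z sinh t)) dt. As ε → 0
the sinh part cancels by oddness, and the cosh part gives (π/2) J₀(z) by the Mehler–Sonine integral,
obtained from Cauchy's theorem on a rectangle. A bound uniform in x and ε
(`abs_integral_sin_div_mul_cos_le`) allows dominated convergence against F. The sine form of the
circle formula is then the Bessel form with α = π²n/y. -/

theorem prod_odd_div_even (n : ℕ) :
    ∏ i ∈ Finset.range n, (2 * (i : ℝ) + 1) / (2 * i + 2) =
      ((2 * n).factorial : ℝ) / (4 ^ n * (n.factorial : ℝ) ^ 2) := by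
  induction n with
  | zero => simp
  | succ n ih =>
    rw [Finset.prod_range_succ, ih, show 2 * (n + 1) = 2 * n + 1 + 1 by ring,
      Nat.factorial_succ, Nat.factorial_succ, Nat.factorial_succ]
    have := Nat.factorial_ne_zero n
    have := Nat.factorial_ne_zero (2 * n)
    push_cast
    field_simp
    ring

/-- Bessel's integral for `J₀`. -/
theorem integral_cos_mul_sin_eq_besselJZero (z : ℝ) :
    ∫ θ in 0..π, cos (z * sin θ) = π * besselJZero z := by
  have h : HasSum (fun n : ℕ => ∫ θ in 0..π,
      (-1 : ℝ) ^ n * (z * sin θ) ^ (2 * n) / ((2 * n).factorial : ℝ))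
      (∫ θ in 0..π, cos (z * sin θ)) := by
    refine intervalIntegral.hasSum_integral_of_dominated_convergence
      (fun n _ => |z| ^ (2 * n) / ((2 * n).factorial : ℝ))
      (fun n => (by fun_prop : Continuous _).aestronglyMeasurable) ?_ ?_ ?_ ?_
    · refine fun n => ae_of_all _ fun θ _ => ?_
      rw [norm_div, norm_mul, norm_pow, norm_neg, norm_one, one_pow, one_mul, norm_pow,
        Real.norm_natCast, norm_mul, Real.norm_eq_abs, Real.norm_eq_abs]
      gcongr
      exact mul_le_of_le_one_right (abs_nonneg _) (abs_sin_le_one θ)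
    · exact ae_of_all _ fun θ _ => (Real.hasSum_cosh |z|).summable
    · simp
    · exact ae_of_all _ fun θ _ => Real.hasSum_cos (z * sin θ)
  rw [besselJZero, ← tsum_mul_left, ← h.tsum_eq]
  refine tsum_congr fun n => ?_
  have e : ∀ θ : ℝ, (-1 : ℝ) ^ n * (z * sin θ) ^ (2 * n) / ((2 * n).factorial : ℝ) =
      ((-1 : ℝ) ^ n * z ^ (2 * n) / ((2 * n).factorial : ℝ)) * sin θ ^ (2 * n) :=
    fun θ => by ring
  simp_rw [e]
  rw [intervalIntegral.integral_const_mul, integral_sin_pow_even, prod_odd_div_even]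
  have := Nat.factorial_ne_zero n
  have := Nat.factorial_ne_zero (2 * n)
  rw [div_pow, pow_mul 2 2 n]
  norm_num
  field_simp

theorem abs_besselJZero_le_one (z : ℝ) : |besselJZero z| ≤ 1 := by
  have h := intervalIntegral.norm_integral_le_of_norm_le_const (a := 0) (b := π) (C := 1)
    (f := fun θ => cos (z * sin θ)) (fun θ _ => abs_cos_le_one _)
  rw [integral_cos_mul_sin_eq_besselJZero, norm_mul, sub_zero, Real.norm_eq_abs,
    abs_of_pos pi_pos, one_mul] at h
  exact le_of_mul_le_mul_left (by simpa using h) pi_pos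

theorem continuous_besselJZero : Continuous besselJZero := by
  have h : besselJZero = fun z => π⁻¹ * ∫ θ in 0..π, cos (z * sin θ) := by
    ext z
    rw [integral_cos_mul_sin_eq_besselJZero]
    field_simp
  rw [h]
  exact continuous_const.mul
    (intervalIntegral.continuous_parametric_intervalIntegral_of_continuous' (by fun_prop) _ _)

theorem besselJZero_zero : besselJZero 0 = 1 := by
  have h := integral_cos_mul_sin_eq_besselJZero 0
  simp only [zero_mul, cos_zero, intervalIntegral.integral_const, sub_zero, smul_eq_mul,
    mul_one] at h
  exact (mul_left_cancel₀ pi_ne_zero (by rw [mul_one]; exact h)).symm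

theorem integral_cos_mul_sin_half (z : ℝ) :
    ∫ θ in 0..(π / 2), cos (z * sin θ) = π / 2 * besselJZero z := by
  have hi : ∀ a b : ℝ, IntervalIntegrable (fun θ => cos (z * sin θ)) volume a b :=
    fun a b => (by fun_prop : Continuous _).intervalIntegrable a b
  have h := intervalIntegral.integral_add_adjacent_intervals (hi 0 (π / 2)) (hi (π / 2) π)
  have h2 := intervalIntegral.integral_comp_sub_left (a := 0) (b := π / 2)
    (fun θ => cos (z * sin θ)) π
  simp only [sin_pi_sub, sub_zero, sub_half] at h2
  rw [← h2, integral_cos_mul_sin_eq_besselJZero] at h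
  linarith

/-- This is how J₀ enters the contour argument: on the imaginary axis cosh(iy) = cos y. -/
theorem integral_cos_mul_cos_half (z : ℝ) :
    ∫ θ in 0..(π / 2), cos (z * cos θ) = π / 2 * besselJZero z := by
  have h2 := intervalIntegral.integral_comp_sub_left (a := 0) (b := π / 2)
    (fun θ => cos (z * sin θ)) (π / 2)
  simp only [sin_pi_div_two_sub, sub_zero, sub_self] at h2
  rw [h2, integral_cos_mul_sin_half]

/-- `J₀` as the angular integral of a plane wave. -/
theorem integral_exp_plane_wave (a b : ℝ) :
    ∫ θ in (-π)..π, Complex.exp (-(Complex.I * ((a * cos θ + b * sin θ : ℝ) : ℂ))) =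
      ((2 * π * besselJZero √(a ^ 2 + b ^ 2) : ℝ) : ℂ) := by
  set ρ := √(a ^ 2 + b ^ 2) with hρ
  -- With w = b + ia, the phase becomes ρ sin(θ + arg w), so periodicity removes the shift.
  set w : ℂ := ⟨b, a⟩ with hw
  have hn : ‖w‖ = ρ := by
    rw [Complex.norm_def, Complex.normSq_mk, hρ]; ring_nf
  have hb : ρ * cos w.arg = b := by rw [← hn, Complex.norm_mul_cos_arg]
  have ha : ρ * sin w.arg = a := by rw [← hn, Complex.norm_mul_sin_arg]
  have key : ∀ θ : ℝ, a * cos θ + b * sin θ = ρ * sin (θ + w.arg) := fun θ => by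
    rw [sin_add]; nth_rw 1 [← ha]; nth_rw 1 [← hb]; ring
  simp_rw [key]
  set g : ℝ → ℂ := fun θ => Complex.exp (-(Complex.I * ((ρ * sin θ : ℝ) : ℂ))) with hg
  have hper : Function.Periodic g (2 * π) := fun θ => by simp only [hg, sin_add_two_pi]
  have hgc : Continuous g := by fun_prop
  calc ∫ θ in (-π)..π, g (θ + w.arg) = ∫ θ in (-π + w.arg)..(π + w.arg), g θ :=
        intervalIntegral.integral_comp_add_right g _
    _ = ∫ θ in (-π)..π, g θ := by
        have := hper.intervalIntegral_add_eq (-π + w.arg) (-π)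
        rwa [show -π + w.arg + 2 * π = π + w.arg by ring, show -π + 2 * π = π by ring] at this
    _ = (∫ θ in (-π)..0, g θ) + ∫ θ in 0..π, g θ :=
        (intervalIntegral.integral_add_adjacent_intervals (hgc.intervalIntegrable _ _)
          (hgc.intervalIntegrable _ _)).symm
    _ = (∫ θ in 0..π, g (-θ)) + ∫ θ in 0..π, g θ := by
        rw [intervalIntegral.integral_comp_neg, neg_zero]
    _ = ∫ θ in 0..π, ((2 * cos (ρ * sin θ) : ℝ) : ℂ) := by
        rw [← intervalIntegral.integral_add (f := fun θ => g (-θ))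
          ((hgc.comp continuous_neg).intervalIntegrable _ _) (hgc.intervalIntegrable _ _)]
        refine intervalIntegral.integral_congr fun θ _ => ?_
        simp only [hg, Complex.ofReal_mul, Complex.ofReal_cos, Complex.ofReal_ofNat,
          Complex.two_cos, sin_neg, Complex.ofReal_neg]
        congr 2 <;> ring
    _ = _ := by
        rw [intervalIntegral.integral_ofReal, intervalIntegral.integral_const_mul,
          integral_cos_mul_sin_eq_besselJZero]
        congr 1; ring

/-! ### The entire function J₀(2√z) and its differential equation. -/

/-- Termwise differentiation of an entire power series with coefficients at most `1 / k!`. -/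
theorem hasDerivAt_tsum_mul_pow {a : ℕ → ℝ} (ha : ∀ k, |a k| ≤ 1 / (k.factorial : ℝ)) (z : ℝ) :
    HasDerivAt (fun w => ∑' k, a k * w ^ k) (∑' k : ℕ, ((k : ℝ) + 1) * a (k + 1) * z ^ k) z := by
  set R := |z| + 1 with hR
  have hR0 : 0 ≤ R := by positivity
  have hb : ∀ (k : ℕ) (w : ℝ), w ∈ Metric.ball (0 : ℝ) R →
      ‖((k : ℝ) + 1) * a (k + 1) * w ^ k‖ ≤ R ^ k / (k.factorial : ℝ) := by
    intro k w hw
    have hw' : |w| ≤ R := by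
      rw [mem_ball_zero_iff, Real.norm_eq_abs] at hw; exact hw.le
    rw [norm_mul, norm_mul, norm_pow, Real.norm_eq_abs, Real.norm_eq_abs, Real.norm_eq_abs,
      abs_of_nonneg (by positivity : (0 : ℝ) ≤ (k : ℝ) + 1)]
    have h1 : ((k : ℝ) + 1) * |a (k + 1)| ≤ 1 / (k.factorial : ℝ) := by
      refine (mul_le_mul_of_nonneg_left (ha (k + 1)) (by positivity)).trans_eq ?_
      rw [Nat.factorial_succ]; push_cast
      have := Nat.factorial_ne_zero k
      field_simp
    calc _ ≤ 1 / (k.factorial : ℝ) * R ^ k := by gcongr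
      _ = _ := by ring
  -- The same majorant before the index shift; at `k = 0` the factor `k` makes the truncated
  -- exponent harmless.
  have hu : Summable fun k : ℕ => (k : ℝ) * R ^ (k - 1) / (k.factorial : ℝ) := by
    rw [← summable_nat_add_iff 1]
    refine (Real.summable_pow_div_factorial R).congr fun k => ?_
    rw [Nat.factorial_succ]; push_cast
    have := Nat.factorial_ne_zero k
    field_simp
  have hz : z ∈ Metric.ball (0 : ℝ) R := by
    rw [mem_ball_zero_iff, Real.norm_eq_abs, hR]; linarith
  have hd := hasDerivAt_tsum_of_isPreconnected (g := fun k w => a k * w ^ k)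
    (g' := fun k w => a k * (k * w ^ (k - 1))) hu Metric.isOpen_ball
    (convex_ball (0 : ℝ) R).isPreconnected
    (fun k w _ => (hasDerivAt_pow k w).const_mul (a k)) ?_ (Metric.mem_ball_self (by positivity))
    (summable_of_ne_finset_zero (s := {0}) fun k hk => by
      simp only [Finset.mem_singleton] at hk; simp [hk]) hz
  · refine hd.congr_deriv ?_
    have hs : Summable fun k : ℕ => a k * ((k : ℝ) * z ^ (k - 1)) := by
      rw [← summable_nat_add_iff 1]
      refine (Summable.of_norm_bounded (Real.summable_pow_div_factorial R)
        fun k => hb k z hz).congr fun k => ?_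
      simp only [Nat.add_sub_cancel]; push_cast; ring
    rw [hs.tsum_eq_zero_add]
    simp only [Nat.cast_zero, zero_mul, mul_zero, zero_add, Nat.add_sub_cancel]
    refine tsum_congr fun k => ?_
    push_cast; ring
  · intro k w hw
    rcases k with _ | k
    · simp
    · have h := hb k w hw
      rw [Nat.factorial_succ]; simp only [Nat.add_sub_cancel]; push_cast
      have e : ((k : ℝ) + 1) * R ^ k / (((k : ℝ) + 1) * (k.factorial : ℝ)) =
          R ^ k / (k.factorial : ℝ) := by
        have := Nat.factorial_ne_zero k
        field_simp
      rw [e]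
      refine le_trans (le_of_eq ?_) h
      congr 1; ring

/-- The entire function `z ↦ J₀(2√z)`. -/
noncomputable def besselCliffordZero (z : ℝ) : ℝ :=
  ∑' k : ℕ, (-1 : ℝ) ^ k / ((k.factorial : ℝ) ^ 2) * z ^ k

/-- The function `z ↦ z * d/dz J₀(2√z)`. -/
noncomputable def besselCliffordZeroFlux (z : ℝ) : ℝ :=
  ∑' k : ℕ, (k : ℝ) * ((-1 : ℝ) ^ k / ((k.factorial : ℝ) ^ 2)) * z ^ k

theorem besselJZero_two_mul_sqrt {z : ℝ} (hz : 0 ≤ z) :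
    besselJZero (2 * √z) = besselCliffordZero z := by
  refine tsum_congr fun k => ?_
  rw [mul_div_cancel_left₀ _ (two_ne_zero), pow_mul, sq_sqrt hz]

theorem hasDerivAt_besselCliffordZero {z : ℝ} (hz : z ≠ 0) :
    HasDerivAt besselCliffordZero (besselCliffordZeroFlux z / z) z := by
  have h := hasDerivAt_tsum_mul_pow (a := fun k => (-1 : ℝ) ^ k / ((k.factorial : ℝ) ^ 2))
    (fun k => ?_) z
  · refine h.congr_deriv ?_
    rw [eq_div_iff hz, ← tsum_mul_right, besselCliffordZeroFlux]
    have hs : Summable fun k : ℕ =>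
        (k : ℝ) * ((-1 : ℝ) ^ k / ((k.factorial : ℝ) ^ 2)) * z ^ k := by
      refine Summable.of_norm_bounded (Real.summable_pow_div_factorial |z|) fun k => ?_
      rw [norm_mul, norm_mul, norm_div, norm_pow, norm_neg, norm_one, one_pow, norm_pow,
        norm_pow, Real.norm_natCast, Real.norm_natCast, Real.norm_eq_abs, mul_one_div,
        div_mul_eq_mul_div, div_le_div_iff₀ (by positivity) (by positivity)]
      have : (k : ℝ) ≤ k.factorial := by exact_mod_cast Nat.self_le_factorial k
      calc _ = (k : ℝ) * (|z| ^ k * k.factorial) := by ring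
        _ ≤ k.factorial * (|z| ^ k * k.factorial) := by gcongr
        _ = _ := by ring
    rw [hs.tsum_eq_zero_add]
    simp only [Nat.cast_zero, zero_mul, zero_add]
    refine tsum_congr fun k => ?_
    push_cast; ring
  · rw [abs_div, abs_pow, abs_neg, abs_one, one_pow, abs_of_nonneg (by positivity)]
    have : (1 : ℝ) ≤ k.factorial := by exact_mod_cast Nat.one_le_iff_ne_zero.2 k.factorial_ne_zero
    gcongr
    exact le_self_pow₀ this two_ne_zero

/-- Together with `hasDerivAt_besselCliffordZero` this is the Bessel equation (z Y')' = -Y as a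
first-order system in Y and z Y'. -/
theorem hasDerivAt_besselCliffordZeroFlux (z : ℝ) :
    HasDerivAt besselCliffordZeroFlux (-besselCliffordZero z) z := by
  have h := hasDerivAt_tsum_mul_pow
    (a := fun k => (k : ℝ) * ((-1 : ℝ) ^ k / ((k.factorial : ℝ) ^ 2))) (fun k => ?_) z
  · refine h.congr_deriv ?_
    rw [besselCliffordZero, ← tsum_neg]
    refine tsum_congr fun k => ?_
    have := Nat.factorial_ne_zero k
    rw [Nat.factorial_succ]; push_cast
    field_simp
    ring
  · rw [abs_mul, abs_div, abs_pow, abs_neg, abs_one, one_pow,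
      abs_of_nonneg (by positivity : (0 : ℝ) ≤ (k.factorial : ℝ) ^ 2), Nat.abs_cast,
      mul_one_div, div_le_div_iff₀ (by positivity) (by positivity)]
    have : (k : ℝ) ≤ k.factorial := by exact_mod_cast Nat.self_le_factorial k
    nlinarith [Nat.cast_nonneg (α := ℝ) k.factorial]

theorem abs_besselCliffordZero_le_one {z : ℝ} (hz : 0 ≤ z) : |besselCliffordZero z| ≤ 1 := by
  rw [← besselJZero_two_mul_sqrt hz]; exact abs_besselJZero_le_one _

theorem besselCliffordZeroFlux_zero : besselCliffordZeroFlux 0 = 0 := by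
  rw [besselCliffordZeroFlux, ← tsum_zero (β := ℕ)]
  refine tsum_congr fun k => ?_
  rcases k with _ | k <;> simp

/-- The flux vanishes at 0 and its derivative is at most 1 in absolute value on [0, ∞). The linear
bound is what makes boundary terms vanish at 0 later. -/
theorem abs_besselCliffordZeroFlux_le {z : ℝ} (hz : 0 ≤ z) : |besselCliffordZeroFlux z| ≤ z := by
  have h := (convex_Ici (0 : ℝ)).norm_image_sub_le_of_norm_hasDerivWithin_le (C := 1)
    (fun x _ => (hasDerivAt_besselCliffordZeroFlux x).hasDerivWithinAt)
    (fun x hx => by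
      rw [norm_neg]; exact abs_besselCliffordZero_le_one hx) (self_mem_Ici) (mem_Ici.2 hz)
  simpa [besselCliffordZeroFlux_zero, abs_of_nonneg hz] using h

theorem continuous_besselCliffordZero : Continuous besselCliffordZero := by
  have h : ∀ k : ℕ, |(-1 : ℝ) ^ k / ((k.factorial : ℝ) ^ 2)| ≤ 1 / (k.factorial : ℝ) := by
    intro k
    rw [abs_div, abs_pow, abs_neg, abs_one, one_pow, abs_of_nonneg (by positivity)]
    have : (1 : ℝ) ≤ k.factorial := by exact_mod_cast Nat.one_le_iff_ne_zero.2 k.factorial_ne_zero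
    gcongr
    exact le_self_pow₀ this two_ne_zero
  exact continuous_iff_continuousAt.2 fun z => (hasDerivAt_tsum_mul_pow h z).continuousAt

/-! ### The Mehler–Sonine integrals and the sine kernel -/

/-- Cauchy's theorem on `[0, T] × [0, π / 2]` for an entire function that is real on the top side. -/
theorem integral_im_eq_of_real_on_top {g : ℂ → ℂ} (hg : Differentiable ℂ g)
    (hr : ∀ x : ℝ, (g (x + (π / 2 : ℝ) * Complex.I)).im = 0) (T : ℝ) :
    ∫ x in 0..T, (g x).im =
      (∫ y in 0..(π / 2), (g (y * Complex.I)).re) -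
        ∫ y in 0..(π / 2), (g (T + y * Complex.I)).re := by
  have h := Complex.integral_boundary_rect_eq_zero_of_differentiableOn g 0
    (T + (π / 2 : ℝ) * Complex.I) hg.differentiableOn
  have hgc := hg.continuous
  have him : ∀ {f : ℝ → ℂ} (_ : Continuous f) (a b : ℝ),
      (∫ x in a..b, f x).im = ∫ x in a..b, (f x).im := fun hf a b =>
    (Complex.imCLM.intervalIntegral_comp_comm (hf.intervalIntegrable a b)).symm
  have hre : ∀ {f : ℝ → ℂ} (_ : Continuous f) (a b : ℝ),
      (∫ x in a..b, f x).re = ∫ x in a..b, (f x).re := fun hf a b =>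
    (Complex.reCLM.intervalIntegral_comp_comm (hf.intervalIntegrable a b)).symm
  -- On the vertical sides dw = i dy, so the imaginary part of Cauchy's relation takes real parts
  -- there; the top side drops out by `hr`.
  have h' := congrArg Complex.im h
  simp only [Complex.zero_re, Complex.zero_im, Complex.add_re, Complex.add_im, Complex.ofReal_re,
    Complex.ofReal_im, Complex.mul_re, Complex.mul_im, Complex.I_re, Complex.I_im, mul_zero,
    mul_one, sub_zero, add_zero, zero_add, Complex.ofReal_zero, zero_mul, Complex.sub_im,
    smul_eq_mul, one_mul] at h'
  rw [him (by fun_prop), him (by fun_prop), hre (by fun_prop), hre (by fun_prop)] at h'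
  simp only [hr, intervalIntegral.integral_zero] at h'
  linarith

/-- The right side of the rectangle disappears as T → ∞: the integrand tends to 0 wherever sin y >
0, that is off y = 0, and is bounded by 1 throughout. -/
theorem tendsto_integral_re_of_norm_le_exp {g : ℂ → ℂ} (hg : Continuous g) {z : ℝ} (hz : 0 < z)
    (hb : ∀ T : ℝ, 0 ≤ T → ∀ y ∈ Icc 0 (π / 2),
      ‖g (T + y * Complex.I)‖ ≤ exp (-(z * sinh T * sin y))) :
    Tendsto (fun T : ℝ => ∫ y in 0..(π / 2), (g (T + y * Complex.I)).re) atTop (𝓝 0) := by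
  have hsub : ∀ y ∈ uIoc 0 (π / 2), y ∈ Icc 0 (π / 2) ∧ 0 < sin y := fun y hy => by
    rw [uIoc_of_le (by positivity)] at hy
    exact ⟨⟨hy.1.le, hy.2⟩, sin_pos_of_pos_of_lt_pi hy.1 (by linarith [hy.2, pi_pos])⟩
  have h := intervalIntegral.tendsto_integral_filter_of_dominated_convergence
    (μ := volume) (a := 0) (b := π / 2) (l := atTop)
    (F := fun (T y : ℝ) => (g (T + y * Complex.I)).re) (f := fun _ => 0) (fun _ => 1)
    (Eventually.of_forall fun T => (by fun_prop : Continuous _).aestronglyMeasurable) ?_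
    (by simp) ?_
  · simpa using h
  · filter_upwards [eventually_ge_atTop 0] with T hT
    refine ae_of_all _ fun y hy => ?_
    refine (Complex.abs_re_le_norm _).trans ((hb T hT y (hsub y hy).1).trans ?_)
    rw [exp_le_one_iff, neg_nonpos]
    exact mul_nonneg (mul_nonneg hz.le (sinh_nonneg_iff.2 hT)) (hsub y hy).2.le
  · refine ae_of_all _ fun y hy => ?_
    have hlim : Tendsto (fun T => exp (-(z * sinh T * sin y))) atTop (𝓝 0) := by
      refine tendsto_exp_neg_atTop_nhds_zero.comp
        (Tendsto.atTop_mul_const (hsub y hy).2 (Tendsto.const_mul_atTop hz ?_))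
      exact tendsto_atTop_mono' _ ((eventually_ge_atTop 0).mono fun T hT =>
        self_le_sinh_iff.2 hT) tendsto_id
    refine squeeze_zero_norm' ?_ hlim
    filter_upwards [eventually_ge_atTop 0] with T hT
    exact (Complex.abs_re_le_norm _).trans (hb T hT y (hsub y hy).1)

theorem abs_integral_re_le {g : ℂ → ℂ} {z : ℝ} (hz : 0 < z)
    (hb : ∀ T : ℝ, 0 ≤ T → ∀ y ∈ Icc 0 (π / 2),
      ‖g (T + y * Complex.I)‖ ≤ exp (-(z * sinh T * sin y))) {T : ℝ} (hT : 0 ≤ T) :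
    |∫ y in 0..(π / 2), (g (T + y * Complex.I)).re| ≤ π / 2 := by
  have h := intervalIntegral.norm_integral_le_of_norm_le_const (a := 0) (b := π / 2) (C := 1)
    (f := fun y : ℝ => (g (T + y * Complex.I)).re) (fun y hy => ?_)
  · simpa [abs_of_pos pi_div_two_pos] using h
  · rw [uIoc_of_le (by positivity)] at hy
    refine (Complex.abs_re_le_norm _).trans ((hb T hT y ⟨hy.1.le, hy.2⟩).trans ?_)
    rw [exp_le_one_iff, neg_nonpos]
    exact mul_nonneg (mul_nonneg hz.le (sinh_nonneg_iff.2 hT))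
      (sin_nonneg_of_nonneg_of_le_pi hy.1.le (by linarith [hy.2, pi_pos]))

theorem exp_I_mul_ofReal_re (r : ℝ) : (Complex.exp (Complex.I * r)).re = cos r := by
  rw [mul_comm, Complex.exp_ofReal_mul_I_re]

theorem exp_I_mul_ofReal_im (r : ℝ) : (Complex.exp (Complex.I * r)).im = sin r := by
  rw [mul_comm, Complex.exp_ofReal_mul_I_im]

theorem cosh_ofReal_add_mul_I (T y : ℝ) : Complex.cosh (T + y * Complex.I) =
    (cosh T * cos y : ℝ) + (sinh T * sin y : ℝ) * Complex.I := by
  rw [Complex.cosh_add, Complex.cosh_mul_I, Complex.sinh_mul_I]; push_cast; ring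

theorem sinh_ofReal_add_mul_I (T y : ℝ) : Complex.sinh (T + y * Complex.I) =
    (sinh T * cos y : ℝ) + (cosh T * sin y : ℝ) * Complex.I := by
  rw [Complex.sinh_add, Complex.cosh_mul_I, Complex.sinh_mul_I]; push_cast; ring

theorem exp_I_mul_mul_add_mul_I (z a b : ℝ) :
    Complex.exp (Complex.I * (z * (a + b * Complex.I))) =
      (exp (-(z * b)) : ℝ) * Complex.exp (Complex.I * (z * a : ℝ)) := by
  rw [Complex.ofReal_exp, ← Complex.exp_add]
  congr 1
  push_cast
  linear_combination (z * b : ℂ) * Complex.I_sq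

theorem norm_exp_I_mul_mul_add_mul_I (z a b : ℝ) :
    ‖Complex.exp (Complex.I * (z * (a + b * Complex.I)))‖ = exp (-(z * b)) := by
  rw [exp_I_mul_mul_add_mul_I, norm_mul, mul_comm Complex.I, Complex.norm_exp_ofReal_mul_I,
    mul_one, Complex.norm_real, norm_of_nonneg (exp_pos _).le]

theorem norm_exp_I_mul_cosh_le (z T y : ℝ) :
    ‖Complex.exp (Complex.I * (z * Complex.cosh (T + y * Complex.I)))‖ ≤
      exp (-(z * sinh T * sin y)) := by
  rw [cosh_ofReal_add_mul_I, norm_exp_I_mul_mul_add_mul_I, mul_assoc]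

/-- Here the exponent is z cosh T sin y, and sinh T ≤ cosh T lets both kernels share one majorant.
-/
theorem norm_exp_I_mul_sinh_le {z : ℝ} (hz : 0 < z) (T : ℝ) {y : ℝ} (hy : y ∈ Icc 0 (π / 2)) :
    ‖Complex.exp (Complex.I * (z * Complex.sinh (T + y * Complex.I)))‖ ≤
      exp (-(z * sinh T * sin y)) := by
  have : 0 ≤ sin y := sin_nonneg_of_nonneg_of_le_pi hy.1 (by linarith [hy.2, pi_pos])
  rw [sinh_ofReal_add_mul_I, norm_exp_I_mul_mul_add_mul_I, mul_assoc]
  gcongr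
  exact (sinh_lt_cosh T).le

/-- The Mehler–Sonine integral truncated at `T`. -/
noncomputable def sinCoshIntegral (z T : ℝ) : ℝ := ∫ t in 0..T, sin (z * cosh t)

/-- The integral of `sin (z sinh t)` truncated at `T`. -/
noncomputable def sinSinhIntegral (z T : ℝ) : ℝ := ∫ t in 0..T, sin (z * sinh t)

/-- On the top side cosh(x + iπ/2) = i sinh x, so exp(iz cosh w) is real there and Cauchy's theorem
applies. -/
theorem sinCoshIntegral_eq (z T : ℝ) : sinCoshIntegral z T =
    π / 2 * besselJZero z - ∫ y in 0..(π / 2),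
      (Complex.exp (Complex.I * (z * Complex.cosh (T + y * Complex.I)))).re := by
  have h := integral_im_eq_of_real_on_top
    (g := fun w => Complex.exp (Complex.I * (z * Complex.cosh w))) (by fun_prop) (fun x => ?_) T
  · simp only [← Complex.ofReal_cosh, Complex.cosh_mul_I, ← Complex.ofReal_cos,
      ← Complex.ofReal_mul, exp_I_mul_ofReal_im, exp_I_mul_ofReal_re] at h
    rw [sinCoshIntegral, h, integral_cos_mul_cos_half]
  · rw [cosh_ofReal_add_mul_I, exp_I_mul_mul_add_mul_I, cos_pi_div_two]
    simp [-Complex.ofReal_exp]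

/-- On the top side sinh(x + iπ/2) = i cosh x. The integral of exp(-z sin y) needs no evaluation,
since it cancels in the end. -/
theorem sinSinhIntegral_eq (z T : ℝ) : sinSinhIntegral z T =
    (∫ y in 0..(π / 2), exp (-(z * sin y))) - ∫ y in 0..(π / 2),
      (Complex.exp (Complex.I * (z * Complex.sinh (T + y * Complex.I)))).re := by
  have h := integral_im_eq_of_real_on_top
    (g := fun w => Complex.exp (Complex.I * (z * Complex.sinh w))) (by fun_prop) (fun x => ?_) T
  · have e : ∀ y : ℝ, (Complex.exp (Complex.I * (z * Complex.sinh (y * Complex.I)))).re =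
        exp (-(z * sin y)) := fun y => by
      have := exp_I_mul_mul_add_mul_I z 0 (sin y)
      simp only [Complex.ofReal_zero, zero_add, mul_zero, Complex.exp_zero, mul_one] at this
      rw [Complex.sinh_mul_I, ← Complex.ofReal_sin, this, Complex.ofReal_re]
    simp only [← Complex.ofReal_sinh, ← Complex.ofReal_mul, exp_I_mul_ofReal_im] at h
    simp only [e] at h
    exact h
  · rw [sinh_ofReal_add_mul_I, exp_I_mul_mul_add_mul_I, cos_pi_div_two]
    simp [-Complex.ofReal_exp]

/-- Opposite parities in T separate the two integrals: between -∞ and ∞ the increment of the cosh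
one doubles, while that of the sinh one is zero. -/
theorem sinCoshIntegral_neg (z T : ℝ) : sinCoshIntegral z (-T) = -sinCoshIntegral z T := by
  have h := intervalIntegral.integral_comp_neg (a := 0) (b := T) fun t => sin (z * cosh t)
  simp only [cosh_neg, neg_zero] at h
  rw [sinCoshIntegral, sinCoshIntegral, h, intervalIntegral.integral_symm]

theorem sinSinhIntegral_neg (z T : ℝ) : sinSinhIntegral z (-T) = sinSinhIntegral z T := by
  have h := intervalIntegral.integral_comp_neg (a := 0) (b := T) fun t => sin (z * sinh t)
  simp only [sinh_neg, mul_neg, sin_neg, neg_zero, intervalIntegral.integral_neg] at h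
  rw [sinSinhIntegral, sinSinhIntegral, intervalIntegral.integral_symm, ← h, neg_neg]

theorem tendsto_sinCoshIntegral {z : ℝ} (hz : 0 < z) :
    Tendsto (sinCoshIntegral z) atTop (𝓝 (π / 2 * besselJZero z)) := by
  have h := tendsto_integral_re_of_norm_le_exp
    (g := fun w => Complex.exp (Complex.I * (z * Complex.cosh w))) (by fun_prop) hz
    (fun T _ y _ => norm_exp_I_mul_cosh_le z T y)
  simpa [funext (sinCoshIntegral_eq z)] using h.const_sub (π / 2 * besselJZero z)

theorem tendsto_sinSinhIntegral {z : ℝ} (hz : 0 < z) :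
    Tendsto (sinSinhIntegral z) atTop (𝓝 (∫ y in 0..(π / 2), exp (-(z * sin y)))) := by
  have h := tendsto_integral_re_of_norm_le_exp
    (g := fun w => Complex.exp (Complex.I * (z * Complex.sinh w))) (by fun_prop) hz
    (fun T _ y hy => norm_exp_I_mul_sinh_le hz T hy)
  simpa [funext (sinSinhIntegral_eq z)] using h.const_sub (∫ y in 0..(π / 2), exp (-(z * sin y)))

theorem abs_sinCoshIntegral_le {z : ℝ} (hz : 0 < z) (T : ℝ) : |sinCoshIntegral z T| ≤ π := by
  wlog hT : 0 ≤ T generalizing T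
  · have := this (-T) (by linarith)
    rwa [sinCoshIntegral_neg, abs_neg] at this
  have h := abs_integral_re_le
    (g := fun w => Complex.exp (Complex.I * (z * Complex.cosh w))) hz
    (fun T _ y _ => norm_exp_I_mul_cosh_le z T y) hT
  have h2 : |π / 2 * besselJZero z| ≤ π / 2 := by
    rw [abs_mul, abs_of_pos (by positivity)]
    exact mul_le_of_le_one_right (by positivity) (abs_besselJZero_le_one z)
  rw [sinCoshIntegral_eq]
  exact (abs_sub _ _).trans (by linarith)

theorem abs_sinSinhIntegral_le {z : ℝ} (hz : 0 < z) (T : ℝ) : |sinSinhIntegral z T| ≤ π := by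
  wlog hT : 0 ≤ T generalizing T
  · have := this (-T) (by linarith)
    rwa [sinSinhIntegral_neg] at this
  have hb : ∀ T : ℝ, 0 ≤ T → ∀ y ∈ Icc 0 (π / 2),
      ‖Complex.exp (Complex.I * (z * Complex.sinh (T + y * Complex.I)))‖ ≤
        exp (-(z * sinh T * sin y)) := fun T _ y hy => norm_exp_I_mul_sinh_le hz T hy
  have h := abs_integral_re_le
    (g := fun w => Complex.exp (Complex.I * (z * Complex.sinh w))) hz hb hT
  have h0 := abs_integral_re_le
    (g := fun w => Complex.exp (Complex.I * (z * Complex.sinh w))) hz hb le_rfl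
  -- At T = 0 the left and right sides of the rectangle coincide, so the integral of exp(-z sin y)
  -- inherits the bound π/2.
  have e := sinSinhIntegral_eq z 0
  rw [sinSinhIntegral, intervalIntegral.integral_same, eq_comm, sub_eq_zero] at e
  rw [sinSinhIntegral_eq, e]
  exact (abs_sub _ _).trans (by linarith)

theorem tendsto_sinCoshIntegral_atBot {z : ℝ} (hz : 0 < z) :
    Tendsto (sinCoshIntegral z) atBot (𝓝 (-(π / 2 * besselJZero z))) := by
  have h := ((tendsto_sinCoshIntegral hz).comp tendsto_neg_atBot_atTop).neg
  simpa [Function.comp_def, sinCoshIntegral_neg] using h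

theorem tendsto_sinSinhIntegral_atBot {z : ℝ} (hz : 0 < z) :
    Tendsto (sinSinhIntegral z) atBot (𝓝 (∫ y in 0..(π / 2), exp (-(z * sin y)))) := by
  have h := (tendsto_sinSinhIntegral hz).comp tendsto_neg_atBot_atTop
  simpa [Function.comp_def, sinSinhIntegral_neg] using h

/-- Since |sin(α/u)| ≤ α/u, the kernel is O(u⁻²) at infinity, so no decay of the Fourier transform
of F is ever needed. -/
theorem integrableOn_sin_div_div {α : ℝ} (hα : 0 < α) {ε : ℝ} (hε : 0 < ε) :
    IntegrableOn (fun u : ℝ => sin (α / u) / u) (Ioi ε) := by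
  have h := (integrableOn_Ioi_rpow_of_lt (by norm_num : (-2 : ℝ) < -1) hε).const_mul α
  refine Integrable.mono' h (by fun_prop : Measurable _).aestronglyMeasurable ?_
  filter_upwards [ae_restrict_mem measurableSet_Ioi] with u hu
  have hu0 : 0 < u := hε.trans hu
  rw [norm_div, Real.norm_eq_abs, Real.norm_eq_abs, abs_of_pos hu0, rpow_neg hu0.le]
  have h1 : |sin (α / u)| ≤ α / u := by
    have := abs_sin_le_abs (x := α / u)
    rwa [abs_of_pos (div_pos hα hu0)] at this
  calc |sin (α / u)| / u ≤ α / u / u := by gcongr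
    _ = _ := by rw [rpow_ofNat]; field_simp

/-- With c = √(α/x) and t = log(u/c), one has xu + α/u = z cosh t and xu - α/u = z sinh t. Half the
difference of the two truncated integrals at t is therefore an antiderivative, evaluated between ε
and ∞. -/
theorem integral_sin_div_mul_cos {α x ε : ℝ} (hα : 0 < α) (hx : 0 < x) (hε : 0 < ε) :
    ∫ u in Ioi ε, sin (α / u) / u * cos (x * u) =
      1 / 2 * (π / 2 * besselJZero (2 * √(α * x)) - ∫ y in 0..(π / 2),
        exp (-(2 * √(α * x) * sin y))) -
      1 / 2 * (sinCoshIntegral (2 * √(α * x)) (log (ε / √(α / x))) -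
        sinSinhIntegral (2 * √(α * x)) (log (ε / √(α / x)))) := by
  set z := 2 * √(α * x) with hz
  set c := √(α / x) with hc
  have hz0 : 0 < z := by positivity
  have hc0 : 0 < c := by positivity
  have hsx : √(α * x) = x * c := by
    rw [hc, ← sqrt_sq hx.le, ← sqrt_mul (sq_nonneg x), sqrt_sq hx.le]; congr 1; field_simp
  have hxc : x * c * c = α := by
    rw [mul_assoc, hc, mul_self_sqrt (by positivity)]; field_simp
  have hlog : ∀ u : ℝ, 0 < u → HasDerivAt (fun u => log (u / c)) (1 / u) u := fun u hu => by
    have := ((hasDerivAt_id u).div_const c).log (div_pos hu hc0).ne'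
    refine this.congr_deriv ?_
    simp only [id]; field_simp
  have hd : ∀ u : ℝ, 0 < u → HasDerivAt
      (fun u => 1 / 2 * (sinCoshIntegral z (log (u / c)) - sinSinhIntegral z (log (u / c))))
      (sin (α / u) / u * cos (x * u)) u := fun u hu => by
    have h1 : HasDerivAt (sinCoshIntegral z) (sin (z * cosh (log (u / c)))) (log (u / c)) :=
      ((by fun_prop : Continuous fun t => sin (z * cosh t)).integral_hasStrictDerivAt
        0 _).hasDerivAt
    have h2 : HasDerivAt (sinSinhIntegral z) (sin (z * sinh (log (u / c)))) (log (u / c)) :=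
      ((by fun_prop : Continuous fun t => sin (z * sinh t)).integral_hasStrictDerivAt
        0 _).hasDerivAt
    refine (((h1.comp u (hlog u hu)).sub (h2.comp u (hlog u hu))).const_mul (1 / 2)).congr_deriv ?_
    have huc : 0 < u / c := by positivity
    have e1 : z * cosh (log (u / c)) = x * u + α / u := by
      rw [cosh_log huc, hz, hsx, ← hxc]; field_simp
    have e2 : z * sinh (log (u / c)) = x * u - α / u := by
      rw [sinh_log huc, hz, hsx, ← hxc]; field_simp
    rw [e1, e2, sin_add, sin_sub]
    ring
  have hlim : Tendsto (fun u => log (u / c)) atTop atTop :=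
    tendsto_log_atTop.comp (tendsto_id.atTop_div_const hc0)
  refine integral_Ioi_of_hasDerivAt_of_tendsto (hd ε hε).continuousAt.continuousWithinAt
    (fun u hu => hd u (hε.trans hu)) ?_
    ((((tendsto_sinCoshIntegral hz0).comp hlim).sub
      ((tendsto_sinSinhIntegral hz0).comp hlim)).const_mul (1 / 2))
  refine Integrable.mul_bdd (c := 1) (integrableOn_sin_div_div hα hε)
    (by fun_prop : Continuous _).aestronglyMeasurable (ae_of_all _ fun u => ?_)
  exact abs_cos_le_one _

/-- Uniformity in both x and ε is the point. The constant is half the sum of four terms, each at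
most π. -/
theorem abs_integral_sin_div_mul_cos_le {α x ε : ℝ} (hα : 0 < α) (hx : 0 < x) (hε : 0 < ε) :
    |∫ u in Ioi ε, sin (α / u) / u * cos (x * u)| ≤ 2 * π := by
  have hz : 0 < 2 * √(α * x) := by positivity
  rw [integral_sin_div_mul_cos hα hx hε]
  have h1 := abs_le.1 (le_of_tendsto (tendsto_sinCoshIntegral hz).abs
    (Eventually.of_forall (abs_sinCoshIntegral_le hz)))
  have h2 := abs_le.1 (le_of_tendsto (tendsto_sinSinhIntegral hz).abs
    (Eventually.of_forall (abs_sinSinhIntegral_le hz)))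
  have h3 := abs_le.1 (abs_sinCoshIntegral_le hz (log (ε / √(α / x))))
  have h4 := abs_le.1 (abs_sinSinhIntegral_le hz (log (ε / √(α / x))))
  rw [abs_le]
  constructor <;> linarith [h1.1, h1.2, h2.1, h2.2, h3.1, h3.2, h4.1, h4.2]

theorem tendsto_integral_sin_div_mul_cos {α x : ℝ} (hα : 0 < α) (hx : 0 < x) :
    Tendsto (fun ε => ∫ u in Ioi ε, sin (α / u) / u * cos (x * u)) (𝓝[>] 0)
      (𝓝 (π / 2 * besselJZero (2 * √(α * x)))) := by
  have hz : 0 < 2 * √(α * x) := by positivity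
  have hc : 0 < √(α / x) := by positivity
  have hlim : Tendsto (fun ε => log (ε / √(α / x))) (𝓝[>] 0) atBot := by
    refine tendsto_log_nhdsGT_zero.comp (tendsto_nhdsWithin_iff.2 ⟨?_, ?_⟩)
    · have : Tendsto (fun ε : ℝ => ε / √(α / x)) (𝓝 0) (𝓝 (0 / √(α / x))) :=
        tendsto_id.div_const _
      rw [zero_div] at this
      exact this.mono_left nhdsWithin_le_nhds
    · filter_upwards [self_mem_nhdsWithin] with ε hε
      exact div_pos hε hc
  have h := ((((tendsto_sinCoshIntegral_atBot hz).comp hlim).sub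
    ((tendsto_sinSinhIntegral_atBot hz).comp hlim)).const_mul (1 / 2)).const_sub
      (1 / 2 * (π / 2 * besselJZero (2 * √(α * x)) - ∫ y in 0..(π / 2),
        exp (-(2 * √(α * x) * sin y))))
  refine Tendsto.congr' ?_ (h.trans_eq ?_)
  · filter_upwards [self_mem_nhdsWithin] with ε hε
    exact (integral_sin_div_mul_cos hα hx hε).symm
  · congr 1; ring

/-! ### Rapidly decaying jets on the half-line and the decay of the Hankel transform -/

/-- `D n` is the `n`-th derivative on `[0, ∞)` of a Schwartz function of the half-line. -/
structure IsHalfLineSchwartzJet (D : ℕ → ℝ → ℂ) : Prop where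
  cont : ∀ n, ContinuousOn (D n) (Ici 0)
  deriv : ∀ n x, 0 < x → HasDerivAt (D n) (D (n + 1) x) x
  decay : ∀ m n : ℕ, ∃ C, ∀ x, 0 ≤ x → x ^ m * ‖D n x‖ ≤ C

/-- The jet of `t ↦ F (-t)` on `[0, ∞)`. -/
noncomputable def reflectedJet (F : ℝ → ℂ) (n : ℕ) (x : ℝ) : ℂ :=
  (-1) ^ n * iteratedDerivWithin n F (Iic 0) (-x)

/-- Inside the half-line the derivatives are two-sided, while at 0 only continuity is kept; a
compact interval plus the limit at -∞ bounds each weighted derivative. -/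
theorem IsEvenHalfLineSchwartz.isHalfLineSchwartzJet {F : ℝ → ℂ} (hF : IsEvenHalfLineSchwartz F) :
    IsHalfLineSchwartzJet (reflectedJet F) := by
  have hc : ∀ n : ℕ, ContinuousOn (iteratedDerivWithin n F (Iic 0)) (Iic 0) := fun n =>
    hF.smooth.continuousOn_iteratedDerivWithin (by exact_mod_cast le_top) (uniqueDiffOn_Iic 0)
  have hc' : ∀ n : ℕ, ContinuousOn (reflectedJet F n) (Ici 0) := fun n =>
    continuousOn_const.mul ((hc n).comp continuousOn_neg fun x hx => by simpa using hx)
  refine ⟨hc', fun n x hx => ?_, fun m n => ?_⟩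
  · have hd : HasDerivAt (iteratedDerivWithin n F (Iic 0))
        (iteratedDerivWithin (n + 1) F (Iic 0) (-x)) (-x) := by
      have hmem : Iic (0 : ℝ) ∈ 𝓝 (-x) := Iic_mem_nhds (by linarith)
      have h := hF.smooth.differentiableOn_iteratedDerivWithin (m := n)
        (by exact_mod_cast WithTop.coe_lt_top n) (uniqueDiffOn_Iic 0) (-x) (mem_of_mem_nhds hmem)
      rw [iteratedDerivWithin_succ]
      exact h.hasDerivWithinAt.hasDerivAt hmem
    have h2 : HasDerivAt (fun y => iteratedDerivWithin n F (Iic 0) (-y))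
        ((-1 : ℝ) • iteratedDerivWithin (n + 1) F (Iic 0) (-x)) x :=
      HasDerivAt.scomp x hd (hasDerivAt_neg x)
    refine (h2.const_mul ((-1 : ℂ) ^ n)).congr_deriv ?_
    rw [reflectedJet, pow_succ]
    simp
  · have h := hF.decay m n
    obtain ⟨A, hA⟩ := eventually_atBot.1 (h.eventually_le_const zero_lt_one)
    obtain ⟨C, hC⟩ := (isCompact_Icc (a := (0 : ℝ)) (b := -A)).exists_bound_of_continuousOn
      (f := fun x => x ^ m * ‖reflectedJet F n x‖)
      ((continuousOn_pow m).mul ((hc' n).norm.mono fun x hx => hx.1))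
    refine ⟨max 1 C, fun x hx => ?_⟩
    rcases le_total x (-A) with h1 | h1
    · exact (le_abs_self _).trans ((hC x ⟨hx, h1⟩).trans (le_max_right _ _))
    · refine le_trans ?_ ((hA (-x) (by linarith)).trans (le_max_left _ _))
      rw [reflectedJet, norm_mul, norm_pow, norm_neg, norm_one, one_pow, one_mul, abs_neg,
        abs_of_nonneg hx]

namespace IsHalfLineSchwartzJet

variable {D : ℕ → ℝ → ℂ}

theorem integrableOn (hD : IsHalfLineSchwartzJet D) (m n : ℕ) :
    IntegrableOn (fun x : ℝ => (x : ℂ) ^ m * D n x) (Ioi 0) := by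
  obtain ⟨C₁, h₁⟩ := hD.decay m n
  obtain ⟨C₂, h₂⟩ := hD.decay (m + 2) n
  refine Integrable.mono' ((integrable_inv_one_add_sq.const_mul (C₁ + C₂)).integrableOn
    (s := Ioi 0)) ?_ ?_
  · exact ((by fun_prop : Continuous fun x : ℝ => (x : ℂ) ^ m).continuousOn.mul
      ((hD.cont n).mono Ioi_subset_Ici_self)).aestronglyMeasurable measurableSet_Ioi
  · filter_upwards [ae_restrict_mem measurableSet_Ioi] with x hx
    have hx0 : 0 ≤ x := le_of_lt hx
    rw [norm_mul, norm_pow, Complex.norm_real, Real.norm_eq_abs, abs_of_nonneg hx0,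
      ← div_eq_mul_inv, le_div_iff₀ (by positivity)]
    have := h₁ x hx0
    have := h₂ x hx0
    rw [pow_add] at this
    nlinarith

theorem tendsto_atTop (hD : IsHalfLineSchwartzJet D) (m n : ℕ) :
    Tendsto (fun x : ℝ => x ^ m * ‖D n x‖) atTop (𝓝 0) := by
  obtain ⟨C, h⟩ := hD.decay (m + 1) n
  refine squeeze_zero' ((eventually_ge_atTop 0).mono fun x hx => by positivity) ?_
    (tendsto_const_nhds.div_atTop tendsto_id : Tendsto (fun x : ℝ => C / x) atTop (𝓝 0))
  filter_upwards [eventually_gt_atTop 0] with x hx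
  rw [le_div_iff₀ hx]
  refine le_trans (le_of_eq ?_) (h x hx.le)
  ring

/-- The jet of `(x f')'`. -/
theorem bessel_operator (hD : IsHalfLineSchwartzJet D) :
    IsHalfLineSchwartzJet fun n x => x * D (n + 2) x + (n + 1) * D (n + 1) x := by
  refine ⟨fun n => ?_, fun n x hx => ?_, fun m n => ?_⟩
  · exact (Complex.continuous_ofReal.continuousOn.mul (hD.cont _)).add
      (continuousOn_const.mul (hD.cont _))
  -- Differentiating the factor x yields one more copy of `D (n + 2) x`, which raises the
  -- coefficient `n + 1` to `n + 2`.
  · refine (((hasDerivAt_id x).ofReal_comp.mul (hD.deriv (n + 2) x hx)).add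
      ((hD.deriv (n + 1) x hx).const_mul ((n : ℂ) + 1))).congr_deriv ?_
    push_cast
    simp only [id]
    ring_nf
  · obtain ⟨C₁, h₁⟩ := hD.decay (m + 1) (n + 2)
    obtain ⟨C₂, h₂⟩ := hD.decay m (n + 1)
    refine ⟨C₁ + (n + 1) * C₂, fun x hx => ?_⟩
    have h3 : ‖(x : ℂ) * D (n + 2) x + ((n : ℂ) + 1) * D (n + 1) x‖ ≤
        x * ‖D (n + 2) x‖ + (n + 1) * ‖D (n + 1) x‖ := by
      refine (norm_add_le _ _).trans_eq ?_
      rw [norm_mul, norm_mul, Complex.norm_real, Real.norm_eq_abs, abs_of_nonneg hx]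
      congr 2
      exact_mod_cast Complex.norm_natCast (n + 1)
    calc _ ≤ x ^ m * (x * ‖D (n + 2) x‖ + (n + 1) * ‖D (n + 1) x‖) := by gcongr
      _ = x ^ (m + 1) * ‖D (n + 2) x‖ + (n + 1) * (x ^ m * ‖D (n + 1) x‖) := by ring
      _ ≤ _ := by
        have := h₁ x hx
        have := h₂ x hx
        gcongr

theorem integrableOn_besselCliffordZero_mul (hD : IsHalfLineSchwartzJet D) {s : ℝ} (hs : 0 ≤ s)
    (m n : ℕ) : IntegrableOn
      (fun x : ℝ => (besselCliffordZero (s * x) : ℂ) * ((x : ℂ) ^ m * D n x)) (Ioi 0) := by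
  refine Integrable.bdd_mul (c := 1) (hD.integrableOn m n) ?_ ?_
  · exact (Complex.continuous_ofReal.comp (continuous_besselCliffordZero.comp
      (continuous_const.mul continuous_id))).aestronglyMeasurable
  · filter_upwards [ae_restrict_mem measurableSet_Ioi] with x hx
    rw [Complex.norm_real]
    exact abs_besselCliffordZero_le_one (mul_nonneg hs (le_of_lt hx))

/-- The Hankel transform turns `f ↦ (x f')'` into multiplication by `-s`. -/
theorem mul_integral_besselCliffordZero (hD : IsHalfLineSchwartzJet D) {s : ℝ} (hs : 0 < s) :
    (s : ℂ) * ∫ x in Ioi (0 : ℝ), (besselCliffordZero (s * x) : ℂ) * D 0 x =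
      -∫ x in Ioi (0 : ℝ), (besselCliffordZero (s * x) : ℂ) * (x * D 2 x + D 1 x) := by
  set y : ℝ → ℂ := fun x => (besselCliffordZero (s * x) : ℂ) with hy
  set w : ℝ → ℂ := fun x => (besselCliffordZeroFlux (s * x) : ℂ) with hw
  have hyb : ∀ x, 0 ≤ x → ‖y x‖ ≤ 1 := fun x hx => by
    rw [hy, Complex.norm_real]; exact abs_besselCliffordZero_le_one (mul_nonneg hs.le hx)
  have hwb : ∀ x, 0 ≤ x → ‖w x‖ ≤ s * x := fun x hx => by
    rw [hw, Complex.norm_real]; exact abs_besselCliffordZeroFlux_le (mul_nonneg hs.le hx)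
  have hy' : ∀ x, 0 < x → HasDerivAt y (w x / x) x := fun x hx => by
    have := (hasDerivAt_besselCliffordZero (mul_pos hs hx).ne').comp x
      ((hasDerivAt_id x).const_mul s)
    refine this.ofReal_comp.congr_deriv ?_
    have : (s : ℂ) ≠ 0 := by exact_mod_cast hs.ne'
    have : (x : ℂ) ≠ 0 := by exact_mod_cast hx.ne'
    simp only [hw]
    push_cast
    field_simp
  have hw' : ∀ x : ℝ, HasDerivAt w (-(s * y x)) x := fun x => by
    have := (hasDerivAt_besselCliffordZeroFlux (s * x)).comp x
      ((hasDerivAt_id x).const_mul s)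
    refine this.ofReal_comp.congr_deriv ?_
    simp only [hy]
    push_cast
    ring
  have hwc : Continuous w := continuous_iff_continuousAt.2 fun x => (hw' x).continuousAt
  have h0 : Tendsto (fun x : ℝ => x) (𝓝[>] 0) (𝓝 0) := tendsto_id.mono_left nhdsWithin_le_nhds
  have hb : ∀ n : ℕ, Tendsto (fun x : ℝ => x * ‖D n x‖) (𝓝[>] 0) (𝓝 0) := fun n => by
    have h2 : Tendsto (fun x => ‖D n x‖) (𝓝[>] 0) (𝓝 ‖D n 0‖) :=
      ((hD.cont n 0 self_mem_Ici).mono Ioi_subset_Ici_self).norm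
    simpa using h0.mul h2
  have hiy : ∀ m n : ℕ, IntegrableOn (fun x : ℝ => y x * ((x : ℂ) ^ m * D n x)) (Ioi 0) :=
    hD.integrableOn_besselCliffordZero_mul hs.le
  have hiw : IntegrableOn (fun x : ℝ => w x * D 1 x) (Ioi 0) := by
    refine Integrable.mono' ((hD.integrableOn 1 1).norm.const_mul s) ?_ ?_
    · exact (hwc.continuousOn.mul
        ((hD.cont 1).mono Ioi_subset_Ici_self)).aestronglyMeasurable measurableSet_Ioi
    · filter_upwards [ae_restrict_mem measurableSet_Ioi] with x hx
      have hx0 : 0 ≤ x := le_of_lt hx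
      rw [norm_mul, norm_mul, pow_one, Complex.norm_of_nonneg hx0, ← mul_assoc]
      gcongr
      exact hwb x hx0
  have hiy2 : IntegrableOn (fun x : ℝ => y x * (x * D 2 x + D 1 x)) (Ioi 0) := by
    refine ((hiy 1 2).add (hiy 0 1)).congr_fun (fun x _ => ?_) measurableSet_Ioi
    simp only [Pi.add_apply, pow_one, pow_zero]; ring
  -- With w = x y' and w' = -s y, this gives ∫ w f' = s ∫ y f; the boundary term w f vanishes at 0
  -- because |w| ≤ s x.
  have e1 := integral_Ioi_mul_deriv_eq_deriv_mul (a := 0) (u := w) (v := D 0) (a' := 0) (b' := 0)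
    (fun x _ => hw' x) (fun x hx => hD.deriv 0 x hx) hiw
    (IntegrableOn.congr_fun ((hiy 0 0).const_mul (-(s : ℂ)))
      (fun x _ => by simp only [Pi.mul_apply, pow_zero]; ring) measurableSet_Ioi)
    (by
      refine squeeze_zero_norm' ?_ (by simpa using (hb 0).const_mul s)
      filter_upwards [self_mem_nhdsWithin] with x hx
      rw [Pi.mul_apply, norm_mul, ← mul_assoc]
      gcongr
      exact hwb x (le_of_lt hx))
    (by
      refine squeeze_zero_norm' ?_ (by simpa using (hD.tendsto_atTop 1 0).const_mul s)
      filter_upwards [eventually_ge_atTop 0] with x hx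
      rw [Pi.mul_apply, norm_mul, ← mul_assoc]
      gcongr
      exact hwb x hx)
  -- This gives ∫ y (x f')' = -∫ w f'; the factor x kills the boundary term y x f' at 0 without any
  -- condition on f'(0).
  have e2 := integral_Ioi_mul_deriv_eq_deriv_mul (a := 0) (u := y)
    (v := fun x : ℝ => (x : ℂ) * D 1 x) (v' := fun x : ℝ => x * D 2 x + D 1 x) (a' := 0) (b' := 0)
    (fun x hx => hy' x hx)
    (fun x hx => ((hasDerivAt_id x).ofReal_comp.mul (hD.deriv 1 x hx)).congr_deriv (by
      simp only [id]; push_cast; ring)) hiy2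
    (hiw.congr_fun (fun x hx => by
      have : (x : ℂ) ≠ 0 := by exact_mod_cast (ne_of_gt hx)
      simp only [Pi.mul_apply]; field_simp) measurableSet_Ioi)
    (by
      refine squeeze_zero_norm' ?_ (hb 1)
      filter_upwards [self_mem_nhdsWithin] with x hx
      have hx0 : 0 ≤ x := le_of_lt hx
      rw [Pi.mul_apply, norm_mul, norm_mul, Complex.norm_of_nonneg hx0]
      exact mul_le_of_le_one_left (by positivity) (hyb x hx0))
    (by
      refine squeeze_zero_norm' ?_ (by simpa using hD.tendsto_atTop 1 1)
      filter_upwards [eventually_ge_atTop 0] with x hx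
      rw [Pi.mul_apply, norm_mul, norm_mul, Complex.norm_of_nonneg hx]
      exact mul_le_of_le_one_left (by positivity) (hyb x hx))
  have e3 : ∫ x in Ioi (0 : ℝ), w x / x * (x * D 1 x) = ∫ x in Ioi (0 : ℝ), w x * D 1 x :=
    setIntegral_congr_fun measurableSet_Ioi fun x hx => by
      have : (x : ℂ) ≠ 0 := by exact_mod_cast (ne_of_gt hx)
      field_simp
  have e4 : ∫ x in Ioi (0 : ℝ), -(s * y x) * D 0 x = -(s * ∫ x in Ioi (0 : ℝ), y x * D 0 x) := by
    rw [← integral_const_mul, ← integral_neg]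
    exact integral_congr_ae (ae_of_all _ fun x => by ring)
  rw [e3] at e2
  rw [e4] at e1
  linear_combination e2 - e1

/-- Quadratic decay of the Hankel transform. -/
theorem exists_sq_mul_norm_integral_le (hD : IsHalfLineSchwartzJet D) : ∃ C, ∀ s : ℝ, 0 < s →
    s ^ 2 * ‖∫ x in Ioi (0 : ℝ), (besselCliffordZero (s * x) : ℂ) * D 0 x‖ ≤ C := by
  have hL := hD.bessel_operator
  set L : ℕ → ℝ → ℂ := fun n x => x * D (n + 2) x + (n + 1) * D (n + 1) x with hLdef
  -- The constant is the L¹ norm of f after two applications of the Bessel operator, since |J₀| ≤ 1.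
  refine ⟨∫ x in Ioi (0 : ℝ), ‖(x : ℂ) * L 2 x + L 1 x‖, fun s hs => ?_⟩
  have e1 := hD.mul_integral_besselCliffordZero hs
  have e2 := hL.mul_integral_besselCliffordZero hs
  have e3 : ∫ x in Ioi (0 : ℝ), (besselCliffordZero (s * x) : ℂ) * L 0 x =
      ∫ x in Ioi (0 : ℝ), (besselCliffordZero (s * x) : ℂ) * (x * D 2 x + D 1 x) := by
    simp [hLdef]
  rw [e3] at e2
  have e4 : (s : ℂ) ^ 2 * ∫ x in Ioi (0 : ℝ), (besselCliffordZero (s * x) : ℂ) * D 0 x =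
      ∫ x in Ioi (0 : ℝ), (besselCliffordZero (s * x) : ℂ) * (x * L 2 x + L 1 x) := by
    linear_combination (s : ℂ) * e1 - e2
  calc _ = ‖(s : ℂ) ^ 2 * ∫ x in Ioi (0 : ℝ), (besselCliffordZero (s * x) : ℂ) * D 0 x‖ := by
        rw [norm_mul, norm_pow, Complex.norm_real, Real.norm_eq_abs, sq_abs]
    _ ≤ _ := by
      rw [e4]
      refine norm_integral_le_of_norm_le ?_ ?_
      · refine Integrable.norm ?_
        refine ((hL.integrableOn 1 2).add (hL.integrableOn 0 1)).congr_fun (fun x _ => ?_)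
          measurableSet_Ioi
        simp only [Pi.add_apply, pow_one, pow_zero, one_mul]
      · filter_upwards [ae_restrict_mem measurableSet_Ioi] with x hx
        rw [norm_mul]
        refine mul_le_of_le_one_left (norm_nonneg _) ?_
        rw [Complex.norm_real]
        exact abs_besselCliffordZero_le_one (mul_nonneg hs.le (le_of_lt hx))

end IsHalfLineSchwartzJet

/-! ### Continuity, decay and the cosine transform of F. -/

namespace IsEvenHalfLineSchwartz

variable {F : ℝ → ℂ}

theorem reflectedJet_zero_apply (hF : IsEvenHalfLineSchwartz F) (x : ℝ) :
    reflectedJet F 0 x = F x := by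
  simp [reflectedJet, hF.even]

theorem apply_abs (hF : IsEvenHalfLineSchwartz F) (t : ℝ) : F |t| = F t := by
  rcases abs_choice t with h | h <;> rw [h]
  exact hF.even t

theorem continuous (hF : IsEvenHalfLineSchwartz F) : Continuous F := by
  have h : Continuous fun t : ℝ => F (-|t|) :=
    hF.smooth.continuousOn.comp_continuous (by fun_prop) fun t => by simp
  simpa [hF.even, hF.apply_abs] using h

theorem exists_pow_mul_norm_le (hF : IsEvenHalfLineSchwartz F) (m : ℕ) :
    ∃ C, ∀ x, 0 ≤ x → x ^ m * ‖F x‖ ≤ C := by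
  obtain ⟨C, h⟩ := hF.isHalfLineSchwartzJet.decay m 0
  exact ⟨C, fun x hx => by simpa only [hF.reflectedJet_zero_apply] using h x hx⟩

theorem exists_norm_le (hF : IsEvenHalfLineSchwartz F) :
    ∃ C, ∀ x, 0 ≤ x → ‖F x‖ ≤ C / (1 + x) ^ 2 := by
  obtain ⟨C₀, h₀⟩ := hF.exists_pow_mul_norm_le 0
  obtain ⟨C₁, h₁⟩ := hF.exists_pow_mul_norm_le 1
  obtain ⟨C₂, h₂⟩ := hF.exists_pow_mul_norm_le 2
  refine ⟨C₀ + 2 * C₁ + C₂, fun x hx => ?_⟩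
  rw [le_div_iff₀ (by positivity)]
  nlinarith [h₀ x hx, h₁ x hx, h₂ x hx]

theorem integrableOn_Ioi (hF : IsEvenHalfLineSchwartz F) : IntegrableOn F (Ioi 0) := by
  simpa [hF.reflectedJet_zero_apply] using hF.isHalfLineSchwartzJet.integrableOn 0 0

theorem integrable (hF : IsEvenHalfLineSchwartz F) : Integrable F := by
  have h := hF.integrableOn_Ioi
  rw [← integrableOn_univ, ← Iic_union_Ioi (a := (0 : ℝ)), integrableOn_union]
  refine ⟨?_, h⟩
  rw [← neg_zero, ← integrableOn_Ici_iff_integrableOn_Ioi] at *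
  have := h.comp_neg_Iic
  simpa [hF.even] using this

theorem fourierHat_eq (hF : IsEvenHalfLineSchwartz F) (u : ℝ) :
    fourierHat F u = ∫ x in Ioi (0 : ℝ), 2 * F x * (cos (x * u) : ℂ) := by
  have hi : Integrable fun x : ℝ => F x * Complex.exp (-(Complex.I * (u : ℂ) * (x : ℂ))) := by
    refine Integrable.mul_bdd (c := 1) hF.integrable
      (by fun_prop : Continuous _).aestronglyMeasurable (ae_of_all _ fun x => ?_)
    rw [show -(Complex.I * (u : ℂ) * (x : ℂ)) = ((-(u * x) : ℝ) : ℂ) * Complex.I by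
      push_cast; ring, Complex.norm_exp_ofReal_mul_I]
  rw [fourierHat, ← intervalIntegral.integral_Iic_add_Ioi (b := 0) hi.integrableOn hi.integrableOn]
  have e := integral_comp_neg_Ioi 0
    fun x : ℝ => F x * Complex.exp (-(Complex.I * (u : ℂ) * (x : ℂ)))
  rw [neg_zero] at e
  have hi' : Integrable fun x : ℝ =>
      F (-x) * Complex.exp (-(Complex.I * (u : ℂ) * ((-x : ℝ) : ℂ))) := hi.comp_neg
  rw [← e, ← integral_add hi'.integrableOn hi.integrableOn]
  refine integral_congr_ae (ae_of_all _ fun x => ?_)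
  simp only [hF.even, Complex.ofReal_cos]
  rw [mul_comm 2 (F x), mul_assoc (F x), Complex.two_cos, ← mul_add]
  push_cast
  congr 3 <;> ring

end IsEvenHalfLineSchwartz

/-! ### The Plancherel identity for the sine kernel -/

namespace IsEvenHalfLineSchwartz

variable {F : ℝ → ℂ}

/-- This justifies Fubini at fixed ε > 0: a product of integrable functions of u and x, times a
bounded cosine. The limit ε → 0 is taken only after the swap. -/
theorem integrable_sin_kernel (hF : IsEvenHalfLineSchwartz F) {α ε : ℝ} (hα : 0 < α)
    (hε : 0 < ε) : Integrable
      (Function.uncurry fun u x : ℝ => ((sin (α / u) / u : ℝ) : ℂ) * (2 * F x * (cos (x * u) : ℂ)))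
      ((volume.restrict (Ioi ε)).prod (volume.restrict (Ioi 0))) := by
  have h0 : IntegrableOn (fun u : ℝ => ((sin (α / u) / u : ℝ) : ℂ)) (Ioi ε) :=
    (integrableOn_sin_div_div hα hε).ofReal
  have h := Integrable.mul_prod h0 (hF.integrableOn_Ioi.const_mul 2)
  have h2 := h.mul_bdd (c := 1) (g := fun p : ℝ × ℝ => (cos (p.2 * p.1) : ℂ))
    (by fun_prop : Continuous _).aestronglyMeasurable
    (ae_of_all _ fun p => by
      rw [Complex.norm_real]; exact abs_cos_le_one _)
  refine h2.congr (ae_of_all _ fun p => ?_)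
  simp only [Function.uncurry]
  push_cast
  ring

theorem sin_mul_fourierHat_div_eq (hF : IsEvenHalfLineSchwartz F) (α u : ℝ) :
    (sin (α / u) : ℂ) * fourierHat F u / (u : ℂ) =
      ∫ x in Ioi (0 : ℝ), ((sin (α / u) / u : ℝ) : ℂ) * (2 * F x * (cos (x * u) : ℂ)) := by
  rw [integral_const_mul, hF.fourierHat_eq]
  push_cast
  ring

theorem integrableOn_sin_mul_fourierHat_div (hF : IsEvenHalfLineSchwartz F) {α ε : ℝ}
    (hα : 0 < α) (hε : 0 < ε) :
    IntegrableOn (fun u : ℝ => (sin (α / u) : ℂ) * fourierHat F u / (u : ℂ)) (Ioi ε) := by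
  simp only [hF.sin_mul_fourierHat_div_eq]
  exact (hF.integrable_sin_kernel hα hε).integral_prod_left

theorem integral_sin_mul_fourierHat_div (hF : IsEvenHalfLineSchwartz F) {α ε : ℝ}
    (hα : 0 < α) (hε : 0 < ε) :
    ∫ u in Ioi ε, (sin (α / u) : ℂ) * fourierHat F u / (u : ℂ) =
      ∫ x in Ioi (0 : ℝ),
        2 * F x * ((∫ u in Ioi ε, sin (α / u) / u * cos (x * u) : ℝ) : ℂ) := by
  simp only [hF.sin_mul_fourierHat_div_eq]
  rw [integral_integral_swap (hF.integrable_sin_kernel hα hε)]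
  refine integral_congr_ae (ae_of_all _ fun x => ?_)
  simp only
  rw [← integral_complex_ofReal, ← integral_const_mul]
  refine integral_congr_ae (ae_of_all _ fun u => ?_)
  push_cast
  ring

theorem hasImproperIntegralAtZero_sin_mul_fourierHat (hF : IsEvenHalfLineSchwartz F) {α : ℝ}
    (hα : 0 < α) : HasImproperIntegralAtZero
      (fun u : ℝ => (sin (α / u) : ℂ) * fourierHat F u / (u : ℂ))
      ((π : ℂ) * ∫ x in Ioi (0 : ℝ), (besselJZero (2 * √(α * x)) : ℂ) * F x) := by
  refine ⟨fun ε hε => hF.integrableOn_sin_mul_fourierHat_div hα hε, ?_⟩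
  have h := tendsto_integral_filter_of_dominated_convergence
    (μ := volume.restrict (Ioi (0 : ℝ))) (l := 𝓝[>] (0 : ℝ))
    (F := fun ε x => 2 * F x * ((∫ u in Ioi ε, sin (α / u) / u * cos (x * u) : ℝ) : ℂ))
    (f := fun x => 2 * F x * ((π / 2 * besselJZero (2 * √(α * x)) : ℝ) : ℂ))
    (fun x => 2 * ‖F x‖ * (2 * π)) ?_ ?_ ((hF.integrableOn_Ioi.norm.const_mul 2).mul_const _) ?_
  · rw [← integral_const_mul]
    refine Tendsto.congr' ?_ (h.trans_eq ?_)
    · filter_upwards [self_mem_nhdsWithin] with ε hε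
      exact (hF.integral_sin_mul_fourierHat_div hα hε).symm
    · congr 1
      refine integral_congr_ae (ae_of_all _ fun x => ?_)
      push_cast
      ring
  -- Measurability in x of the inner integral is read off from Fubini.
  · filter_upwards [self_mem_nhdsWithin] with ε hε
    have h1 := (hF.integrable_sin_kernel hα hε).integral_prod_right
    refine h1.aestronglyMeasurable.congr (ae_of_all _ fun x => ?_)
    simp only [Function.uncurry]
    rw [← integral_complex_ofReal, ← integral_const_mul]
    refine integral_congr_ae (ae_of_all _ fun u => ?_)
    push_cast
    ring
  · filter_upwards [self_mem_nhdsWithin] with ε hε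
    filter_upwards [ae_restrict_mem measurableSet_Ioi] with x hx
    rw [norm_mul, norm_mul, Complex.norm_real, Complex.norm_ofNat]
    gcongr
    exact abs_integral_sin_div_mul_cos_le hα hx hε
  · filter_upwards [ae_restrict_mem measurableSet_Ioi] with x hx
    exact ((Complex.continuous_ofReal.tendsto _).comp
      (tendsto_integral_sin_div_mul_cos hα hx)).const_mul _

theorem integrableOn_besselJZero_mul (hF : IsEvenHalfLineSchwartz F) {g : ℝ → ℝ}
    (hg : Continuous g) : IntegrableOn (fun x : ℝ => (besselJZero (g x) : ℂ) * F x) (Ioi 0) := by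
  refine Integrable.bdd_mul (c := 1) hF.integrableOn_Ioi
    (Complex.continuous_ofReal.comp (continuous_besselJZero.comp hg)).aestronglyMeasurable
    (ae_of_all _ fun x => ?_)
  rw [Complex.norm_real]
  exact abs_besselJZero_le_one _

end IsEvenHalfLineSchwartz

/-! ### Poisson summation in the plane -/

/-- The two-dimensional Fourier transform, as an iterated integral. -/
noncomputable def planeFourier (g : ℝ → ℝ → ℂ) (n m : ℝ) : ℂ :=
  FourierTransform.fourier (fun v : ℝ => FourierTransform.fourier (fun u : ℝ => g u v) n) m

theorem tsum_int_eq_tsum_fourier {f : ℝ → ℂ} (hf : Continuous f) {C : ℝ}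
    (hb : ∀ x, ‖f x‖ ≤ C * (1 + x ^ 2)⁻¹)
    (hs : Summable fun n : ℤ => FourierTransform.fourier f (n : ℝ)) :
    ∑' n : ℤ, f n = ∑' n : ℤ, FourierTransform.fourier f (n : ℝ) := by
  have hO : f =O[cocompact ℝ] fun x : ℝ => |x| ^ (-(2 : ℝ)) := by
    refine Asymptotics.IsBigO.of_bound |C| ?_
    have hne : ∀ᶠ x : ℝ in cocompact ℝ, x ≠ 0 := by
      have := (isCompact_singleton (x := (0 : ℝ))).compl_mem_cocompact
      filter_upwards [this] with x hx using hx
    filter_upwards [hne] with x hx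
    rw [rpow_neg (abs_nonneg x), rpow_ofNat, sq_abs, norm_inv, norm_pow, Real.norm_eq_abs, sq_abs]
    refine (hb x).trans ?_
    have : 0 < x ^ 2 := by positivity
    gcongr
    · exact le_abs_self C
    · linarith
  simpa using Real.tsum_eq_tsum_fourier_of_rpow_decay_of_summable hf one_lt_two hO hs 0

theorem summable_int_inv_one_add_sq : Summable fun n : ℤ => (1 + (n : ℝ) ^ 2)⁻¹ := by
  refine Summable.of_nonneg_of_le (fun n => by positivity) (fun n => ?_)
    ((Real.summable_one_div_int_pow (p := 2)).2 one_lt_two |>.add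
      (summable_of_ne_finset_zero (s := {0}) (f := fun n : ℤ => if n = 0 then (1 : ℝ) else 0)
        fun n hn => by simp at hn; simp [hn]))
  by_cases h : n = 0
  · simp [h]
  · have : (0 : ℝ) < (n : ℝ) ^ 2 := by positivity
    simp only [h, if_false, add_zero, one_div]
    gcongr
    linarith

/-- One-dimensional Poisson summation is used twice: in v, for the partial transform at each integer
frequency n, then in u, for the sum over the second coordinate. The product bound gives both
functions the required quadratic decay. -/
theorem tsum_tsum_int_eq_tsum_planeFourier {g : ℝ → ℝ → ℂ} (hg : Continuous (Function.uncurry g))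
    {C : ℝ} (hb : ∀ u v, ‖g u v‖ ≤ C * ((1 + u ^ 2)⁻¹ * (1 + v ^ 2)⁻¹))
    (hs : Summable fun p : ℤ × ℤ => planeFourier g p.1 p.2) :
    ∑' (a : ℤ) (b : ℤ), g a b = ∑' p : ℤ × ℤ, planeFourier g p.1 p.2 := by
  have hC : 0 ≤ C := by simpa using (norm_nonneg _).trans (hb 0 0)
  have hgu : ∀ v, Continuous fun u => g u v := fun v =>
    hg.comp (by fun_prop : Continuous fun u : ℝ => (u, v))
  have hgv : ∀ u, Continuous fun v => g u v := fun u =>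
    hg.comp (by fun_prop : Continuous fun v : ℝ => (u, v))
  have hexp : ∀ u n : ℝ, ‖Complex.exp (((-2 * π * u * n : ℝ) : ℂ) * Complex.I)‖ = 1 := fun u n =>
    Complex.norm_exp_ofReal_mul_I _
  -- the partial Fourier transform in the first variable
  set E : ℝ → ℝ → ℂ := fun n v => FourierTransform.fourier (fun u : ℝ => g u v) n with hE
  have hEeq : ∀ n v, E n v =
      ∫ u : ℝ, Complex.exp (((-2 * π * u * n : ℝ) : ℂ) * Complex.I) • g u v := fun n v =>
    Real.fourier_real_eq_integral_exp_smul _ _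
  have hbound : ∀ n u v, ‖Complex.exp (((-2 * π * u * n : ℝ) : ℂ) * Complex.I) • g u v‖ ≤
      C * ((1 + u ^ 2)⁻¹ * (1 + v ^ 2)⁻¹) := fun n u v => by
    rw [norm_smul, hexp, one_mul]; exact hb u v
  have hmeas : ∀ n v, AEStronglyMeasurable
      (fun u : ℝ => Complex.exp (((-2 * π * u * n : ℝ) : ℂ) * Complex.I) • g u v) := fun n v => by
    have := hgu v
    exact (by fun_prop : Continuous _).aestronglyMeasurable
  have hint : ∀ v, Integrable fun u : ℝ => C * ((1 + u ^ 2)⁻¹ * (1 + v ^ 2)⁻¹) := fun v =>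
    (integrable_inv_one_add_sq.mul_const _).const_mul _
  have hEc : ∀ n, Continuous (E n) := fun n => by
    rw [show E n = _ from funext (hEeq n)]
    refine continuous_of_dominated (bound := fun u => C * (1 + u ^ 2)⁻¹) (hmeas n) (fun v => ?_)
      (integrable_inv_one_add_sq.const_mul _) (ae_of_all _ fun u => ?_)
    · refine ae_of_all _ fun u => (hbound n u v).trans ?_
      gcongr
      refine mul_le_of_le_one_right (by positivity) (inv_le_one_of_one_le₀ ?_)
      nlinarith [sq_nonneg v]
    · have := hgv u
      fun_prop
  have hEb : ∀ n v, ‖E n v‖ ≤ (C * π) * (1 + v ^ 2)⁻¹ := fun n v => by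
    rw [hEeq]
    refine (norm_integral_le_of_norm_le (hint v)
      (ae_of_all _ fun u => hbound n u v)).trans_eq ?_
    rw [integral_const_mul, integral_mul_const, integral_univ_inv_one_add_sq]
    ring
  have hEsum : ∀ n : ℤ, ∑' b : ℤ, E n b = ∑' m : ℤ, planeFourier g n m := fun n =>
    tsum_int_eq_tsum_fourier (hEc n) (hEb n) (hs.prod_factor n)
  -- the sum over the second variable
  set h : ℝ → ℂ := fun u => ∑' b : ℤ, g u b with hh
  have hsum : ∀ D : ℝ, Summable fun b : ℤ => D * (1 + (b : ℝ) ^ 2)⁻¹ := fun D =>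
    summable_int_inv_one_add_sq.mul_left D
  have hhc : Continuous h := by
    refine continuous_tsum (fun b : ℤ => hgu b) (hsum C) fun b u => (hb u b).trans ?_
    gcongr
    refine mul_le_of_le_one_left (by positivity) (inv_le_one_of_one_le₀ ?_)
    nlinarith [sq_nonneg u]
  have hhb : ∀ u, ‖h u‖ ≤ (C * ∑' b : ℤ, (1 + (b : ℝ) ^ 2)⁻¹) * (1 + u ^ 2)⁻¹ := fun u => by
    have hs1 : HasSum (fun b : ℤ => C * ((1 + u ^ 2)⁻¹ * (1 + (b : ℝ) ^ 2)⁻¹)) _ :=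
      (summable_int_inv_one_add_sq.hasSum.mul_left _).mul_left C
    exact (tsum_of_norm_bounded hs1 fun b => hb u b).trans_eq (by ring)
  -- The link between the two applications: the sum over b commutes with the Fourier integral in u.
  have hhF : ∀ n : ℝ, FourierTransform.fourier h n = ∑' b : ℤ, E n b := fun n => by
    rw [Real.fourier_real_eq_integral_exp_smul]
    simp only [hEeq]
    rw [integral_tsum_of_summable_integral_norm]
    · refine integral_congr_ae (ae_of_all _ fun u => ?_)
      simp only [hh, smul_eq_mul]
      rw [tsum_mul_left]
    · exact fun b => (hint b).mono' (hmeas n b) (ae_of_all _ fun u => hbound n u b)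
    · refine Summable.of_nonneg_of_le (fun b => integral_nonneg fun u => norm_nonneg _)
        (fun b => ?_) (hsum (C * π))
      refine (integral_mono ((hint b).mono' (hmeas n b)
        (ae_of_all _ fun u => hbound n u b)).norm (hint b) fun u => hbound n u b).trans_eq ?_
      rw [integral_const_mul, integral_mul_const, integral_univ_inv_one_add_sq]
      ring
  have hhF' : ∀ n : ℤ, FourierTransform.fourier h (n : ℝ) = ∑' m : ℤ, planeFourier g n m :=
    fun n => (hhF n).trans (hEsum n)
  have hfin := tsum_int_eq_tsum_fourier hhc hhb (by simpa only [hhF'] using hs.prod)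
  simp only [hhF'] at hfin
  rw [hs.tsum_prod]
  exact hfin

/-- The plane Fourier transform as a double integral. -/
theorem planeFourier_eq_integral {g : ℝ → ℝ → ℂ} (hg : Integrable (Function.uncurry g))
    (n m : ℝ) : planeFourier g n m = ∫ p : ℝ × ℝ,
      Complex.exp (-(Complex.I * ((2 * π * (n * p.1 + m * p.2) : ℝ) : ℂ))) * g p.1 p.2 := by
  have hi : Integrable (fun p : ℝ × ℝ =>
      Complex.exp (-(Complex.I * ((2 * π * (n * p.1 + m * p.2) : ℝ) : ℂ))) * g p.1 p.2) := by
    refine Integrable.bdd_mul (c := 1) hg (by fun_prop : Continuous _).aestronglyMeasurable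
      (ae_of_all _ fun p => ?_)
    rw [← mul_neg, ← Complex.ofReal_neg, mul_comm, Complex.norm_exp_ofReal_mul_I]
  rw [Measure.volume_eq_prod] at hi ⊢
  rw [integral_prod_symm _ hi, planeFourier, Real.fourier_real_eq_integral_exp_smul]
  refine integral_congr_ae (ae_of_all _ fun v => ?_)
  simp only [Real.fourier_real_eq_integral_exp_smul, smul_eq_mul]
  rw [← integral_const_mul]
  refine integral_congr_ae (ae_of_all _ fun u => ?_)
  simp only
  rw [← mul_assoc, ← Complex.exp_add]
  congr 2
  push_cast
  ring

/-- The Fourier transform of a radial function of the plane is a Hankel transform. -/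
theorem planeFourier_radial {f : ℝ → ℂ} (hf1 : IntegrableOn f (Ioi 0))
    (hf : Integrable (Function.uncurry fun u v : ℝ => f (u ^ 2 + v ^ 2))) (n m : ℝ) :
    planeFourier (fun u v => f (u ^ 2 + v ^ 2)) n m =
      π * ∫ x in Ioi (0 : ℝ), (besselJZero (2 * π * √((n ^ 2 + m ^ 2) * x)) : ℂ) * f x := by
  have hrad : IntegrableOn (fun r : ℝ => (r : ℂ) * f (r ^ 2)) (Ioi 0) := by
    have h := ((integrableOn_Ioi_comp_rpow_iff f two_ne_zero).2 hf1).const_mul (1 / 2)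
    refine IntegrableOn.congr_fun h (fun r _ => ?_) measurableSet_Ioi
    simp only [abs_two, rpow_ofNat, Complex.real_smul]
    norm_num
    ring
  have hi : IntegrableOn (fun p : ℝ × ℝ => ((p.1 : ℂ) * f (p.1 ^ 2)) *
      Complex.exp (-(Complex.I *
        ((2 * π * n * p.1 * cos p.2 + 2 * π * m * p.1 * sin p.2 : ℝ) : ℂ))))
      (Ioi 0 ×ˢ Ioo (-π) π) (volume.prod volume) := by
    rw [IntegrableOn, ← Measure.prod_restrict]
    have h1 := Integrable.mul_prod (ν := volume.restrict (Ioo (-π) π)) hrad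
      (integrable_const (1 : ℂ))
    simp only [mul_one] at h1
    refine h1.mul_bdd (c := 1) (by fun_prop : Continuous _).aestronglyMeasurable
      (ae_of_all _ fun p => ?_)
    rw [← mul_neg, ← Complex.ofReal_neg, mul_comm, Complex.norm_exp_ofReal_mul_I]
  have e1 : ∀ p : ℝ × ℝ, p.1 • (Complex.exp (-(Complex.I * ((2 * π * (n * (polarCoord.symm p).1 +
      m * (polarCoord.symm p).2) : ℝ) : ℂ))) *
        f ((polarCoord.symm p).1 ^ 2 + (polarCoord.symm p).2 ^ 2)) =
      ((p.1 : ℂ) * f (p.1 ^ 2)) * Complex.exp (-(Complex.I *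
        ((2 * π * n * p.1 * cos p.2 + 2 * π * m * p.1 * sin p.2 : ℝ) : ℂ))) := fun p => by
    rw [polarCoord_symm_apply, Complex.real_smul]
    simp only
    rw [mul_pow, mul_pow, ← mul_add, cos_sq_add_sin_sq, mul_one,
      show 2 * π * (n * (p.1 * cos p.2) + m * (p.1 * sin p.2)) =
        2 * π * n * p.1 * cos p.2 + 2 * π * m * p.1 * sin p.2 by ring]
    ring
  rw [planeFourier_eq_integral hf, ← integral_comp_polarCoord_symm, polarCoord_target]
  simp only [e1]
  -- The substitution x = r² has r dr = dx/2, which turns the angular factor 2π into π.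
  rw [Measure.volume_eq_prod, setIntegral_prod _ hi, ← integral_comp_rpow_Ioi
    (fun x => (besselJZero (2 * π * √((n ^ 2 + m ^ 2) * x)) : ℂ) * f x) two_ne_zero,
    ← integral_const_mul]
  refine setIntegral_congr_fun measurableSet_Ioi fun r hr => ?_
  have hr0 : (0 : ℝ) ≤ r := le_of_lt hr
  simp only [integral_const_mul]
  rw [← integral_Ioc_eq_integral_Ioo, ← intervalIntegral.integral_of_le (by linarith [pi_pos]),
    integral_exp_plane_wave,
    show (2 * π * n * r) ^ 2 + (2 * π * m * r) ^ 2 = (2 * π) ^ 2 * ((n ^ 2 + m ^ 2) * r ^ 2) by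
      ring, sqrt_mul (sq_nonneg _), sqrt_sq (by positivity), abs_two, rpow_ofNat,
    Complex.real_smul]
  norm_num
  ring

/-! ### Lattice sums and the circle formula -/

/-- The squared norm of a point of `ℤ²`. -/
def latticeNormSq (p : ℤ × ℤ) : ℕ := p.1.natAbs ^ 2 + p.2.natAbs ^ 2

theorem latticeNormSq_cast (p : ℤ × ℤ) :
    ((latticeNormSq p : ℕ) : ℝ) = (p.1 : ℝ) ^ 2 + (p.2 : ℝ) ^ 2 := by
  have h : ((latticeNormSq p : ℕ) : ℤ) = p.1 ^ 2 + p.2 ^ 2 := by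
    simp [latticeNormSq]
  exact_mod_cast congrArg (Int.cast : ℤ → ℝ) h

theorem sumTwoSquaresCount_eq_card (n : ℕ) :
    sumTwoSquaresCount n = Nat.card {p : ℤ × ℤ // latticeNormSq p = n} := by
  rw [sumTwoSquaresCount, ← Nat.card_coe_set_eq]
  refine Nat.card_congr (Equiv.subtypeEquivRight fun p => ?_)
  rw [mem_ofPred_eq, latticeNormSq, ← Int.natCast_inj]
  simp

theorem sumTwoSquaresCount_zero : sumTwoSquaresCount 0 = 1 := by
  rw [sumTwoSquaresCount, ncard_eq_one]
  refine ⟨(0, 0), ?_⟩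
  ext ⟨a, b⟩
  simp only [mem_ofPred_eq, mem_singleton_iff, Prod.mk.injEq, Nat.cast_zero]
  constructor
  · intro h
    constructor <;> nlinarith [sq_nonneg a, sq_nonneg b]
  · rintro ⟨rfl, rfl⟩; rfl

/-- Turns decay of order n⁻² in n = a² + b² into a product of summable, and integrable, one-variable
bounds. -/
theorem inv_one_add_add_sq_le (a b : ℝ) :
    ((1 + (a ^ 2 + b ^ 2)) ^ 2)⁻¹ ≤ (1 + a ^ 2)⁻¹ * (1 + b ^ 2)⁻¹ := by
  rw [← mul_inv]
  gcongr
  nlinarith [sq_nonneg a, sq_nonneg b, mul_nonneg (sq_nonneg a) (sq_nonneg b)]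

theorem summable_comp_latticeNormSq {φ : ℕ → ℂ} {C : ℝ}
    (hφ : ∀ n, ‖φ n‖ ≤ C / (1 + (n : ℝ)) ^ 2) :
    Summable fun p : ℤ × ℤ => φ (latticeNormSq p) := by
  have hC : 0 ≤ C := by simpa using (norm_nonneg _).trans (hφ 0)
  have h := (summable_int_inv_one_add_sq.mul_of_nonneg summable_int_inv_one_add_sq
    (fun n => by positivity) (fun n => by positivity)).mul_left C
  refine Summable.of_norm_bounded h fun p => (hφ _).trans ?_
  rw [latticeNormSq_cast, div_eq_mul_inv]
  gcongr
  exact inv_one_add_add_sq_le _ _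

theorem hasSum_sumTwoSquaresCount_mul {φ : ℕ → ℂ}
    (hφ : Summable fun p : ℤ × ℤ => φ (latticeNormSq p)) :
    HasSum (fun n : ℕ => (sumTwoSquaresCount n : ℂ) * φ n)
      (∑' p : ℤ × ℤ, φ (latticeNormSq p)) := by
  have h := (Equiv.sigmaFiberEquiv latticeNormSq).hasSum_iff.2 hφ.hasSum
  refine h.sigma fun n => ?_
  have hs := (((Equiv.sigmaFiberEquiv latticeNormSq).summable_iff.2 hφ).sigma_factor n).hasSum
  have e : (sumTwoSquaresCount n : ℂ) * φ n =
      ∑' p : {p : ℤ × ℤ // latticeNormSq p = n}, φ (latticeNormSq p) := by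
    -- `Nat.card` and the sum of a constant both default to 0 on an infinite type, so finiteness of
    -- the fibres need not be proved.
    rw [sumTwoSquaresCount_eq_card, ← nsmul_eq_mul, ← tsum_const]
    exact tsum_congr fun p => congrArg φ p.2.symm
  rw [e]
  exact hs

/-! ### Decay of both sides and the assembly of the circle formula. -/

namespace IsEvenHalfLineSchwartz

variable {F : ℝ → ℂ}

theorem exists_norm_hankel_le (hF : IsEvenHalfLineSchwartz F) {y : ℝ} (hy : 0 < y) :
    ∃ C, ∀ n : ℕ, ‖∫ x in Ioi (0 : ℝ), (besselJZero (2 * π * √(n * x / y)) : ℂ) * F x‖ ≤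
      C / (1 + (n : ℝ)) ^ 2 := by
  obtain ⟨C, hC⟩ := hF.isHalfLineSchwartzJet.exists_sq_mul_norm_integral_le
  have hC0 : 0 ≤ C := le_trans (by positivity) (hC 1 one_pos)
  set A := ‖∫ x in Ioi (0 : ℝ), (besselJZero (2 * π * √((0 : ℕ) * x / y)) : ℂ) * F x‖ with hA
  have hA0 : 0 ≤ A := norm_nonneg _
  -- `A` covers n = 0, where the Hankel bound says nothing. For n ≥ 1 that bound is taken at s =
  -- π²n/y, and 4 comes from (1 + n)² ≤ 4n².
  refine ⟨A + 4 * C * y ^ 2 / π ^ 4, fun n => ?_⟩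
  rcases Nat.eq_zero_or_pos n with rfl | hn
  · rw [← hA]
    simp only [Nat.cast_zero, add_zero, one_pow, div_one]
    have : 0 ≤ 4 * C * y ^ 2 / π ^ 4 := by positivity
    linarith
  · have hn1 : (1 : ℝ) ≤ n := by exact_mod_cast hn
    have hs : 0 < π ^ 2 * n / y := by positivity
    have h := hC _ hs
    have e : ∫ x in Ioi (0 : ℝ), (besselCliffordZero (π ^ 2 * n / y * x) : ℂ) * reflectedJet F 0 x =
        ∫ x in Ioi (0 : ℝ), (besselJZero (2 * π * √(n * x / y)) : ℂ) * F x := by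
      refine setIntegral_congr_fun measurableSet_Ioi fun x hx => ?_
      have hx0 : (0 : ℝ) ≤ x := le_of_lt hx
      simp only [hF.reflectedJet_zero_apply]
      rw [← besselJZero_two_mul_sqrt (by positivity),
        show π ^ 2 * n / y * x = π ^ 2 * (n * x / y) by ring, sqrt_mul (sq_nonneg π),
        sqrt_sq pi_pos.le, mul_assoc]
    rw [e] at h
    set H := ‖∫ x in Ioi (0 : ℝ), (besselJZero (2 * π * √(n * x / y)) : ℂ) * F x‖
    have hH : 0 ≤ H := norm_nonneg _
    have h2 : (n : ℝ) ^ 2 * H ≤ C * y ^ 2 / π ^ 4 := by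
      rw [le_div_iff₀ (by positivity)]
      calc (n : ℝ) ^ 2 * H * π ^ 4 = (π ^ 2 * n / y) ^ 2 * H * y ^ 2 := by field_simp
        _ ≤ C * y ^ 2 := by gcongr
    rw [le_div_iff₀ (by positivity)]
    have h3 : (1 + (n : ℝ)) ^ 2 ≤ 4 * n ^ 2 := by nlinarith
    calc H * (1 + (n : ℝ)) ^ 2 ≤ H * (4 * n ^ 2) := by gcongr
      _ = 4 * ((n : ℝ) ^ 2 * H) := by ring
      _ ≤ 4 * (C * y ^ 2 / π ^ 4) := by gcongr
      _ = 4 * C * y ^ 2 / π ^ 4 := by ring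
      _ ≤ _ := by linarith

theorem exists_norm_comp_mul_le (hF : IsEvenHalfLineSchwartz F) {y : ℝ} (hy : 0 < y) :
    ∃ C, 0 ≤ C ∧ ∀ x : ℝ, 0 ≤ x → ‖F (x * y)‖ ≤ C / (1 + x) ^ 2 := by
  obtain ⟨C, hC⟩ := hF.exists_norm_le
  have hC0 : 0 ≤ C := by simpa using (norm_nonneg _).trans (hC 0 le_rfl)
  -- The witness reflects 1 + x ≤ (1 + y⁻¹)(1 + xy).
  refine ⟨C * (1 + y⁻¹) ^ 2, by positivity, fun x hx => (hC _ (by positivity)).trans ?_⟩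
  rw [div_le_div_iff₀ (by positivity) (by positivity), mul_assoc, ← mul_pow]
  gcongr
  have h1 : y⁻¹ * (x * y) = x := by field_simp
  have h2 : 0 ≤ x * y := by positivity
  have h3 : 0 ≤ y⁻¹ := by positivity
  nlinarith

/-- The circle formula, as an identity of sums over `n ≥ 0`. -/
theorem tsum_sumTwoSquaresCount_mul (hF : IsEvenHalfLineSchwartz F) {y : ℝ} (hy : 0 < y) :
    Summable (fun n : ℕ => (sumTwoSquaresCount n : ℂ) * F (n * y)) ∧
    Summable (fun n : ℕ => (sumTwoSquaresCount n : ℂ) *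
      ∫ x in Ioi (0 : ℝ), (besselJZero (2 * π * √(n * x / y)) : ℂ) * F x) ∧
    ∑' n : ℕ, (sumTwoSquaresCount n : ℂ) * F (n * y) =
      (π / y : ℂ) * ∑' n : ℕ, (sumTwoSquaresCount n : ℂ) *
        ∫ x in Ioi (0 : ℝ), (besselJZero (2 * π * √(n * x / y)) : ℂ) * F x := by
  obtain ⟨C, hC0, hC⟩ := hF.exists_norm_comp_mul_le hy
  obtain ⟨C', hC'⟩ := hF.exists_norm_hankel_le hy
  set H : ℕ → ℂ := fun n => ∫ x in Ioi (0 : ℝ), (besselJZero (2 * π * √(n * x / y)) : ℂ) * F x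
    with hH
  have hs1 : Summable fun p : ℤ × ℤ => F ((latticeNormSq p : ℕ) * y) :=
    summable_comp_latticeNormSq (φ := fun n : ℕ => F (n * y)) fun n => hC n n.cast_nonneg
  have hs2 : Summable fun p : ℤ × ℤ => H (latticeNormSq p) :=
    summable_comp_latticeNormSq hC'
  have hh1 := hasSum_sumTwoSquaresCount_mul (φ := fun n : ℕ => F (n * y)) hs1
  have hh2 := hasSum_sumTwoSquaresCount_mul hs2
  refine ⟨hh1.summable, hh2.summable, ?_⟩
  rw [hh1.tsum_eq, hh2.tsum_eq]
  set f : ℝ → ℂ := fun x => F (x * y) with hf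
  have hfc : Continuous f := hF.continuous.comp (by fun_prop)
  have hgc : Continuous (Function.uncurry fun u v : ℝ => f (u ^ 2 + v ^ 2)) :=
    hfc.comp (by fun_prop : Continuous fun p : ℝ × ℝ => p.1 ^ 2 + p.2 ^ 2)
  have hgb : ∀ u v : ℝ, ‖f (u ^ 2 + v ^ 2)‖ ≤ C * ((1 + u ^ 2)⁻¹ * (1 + v ^ 2)⁻¹) := fun u v => by
    refine (hC _ (by positivity)).trans ?_
    rw [div_eq_mul_inv]
    gcongr
    exact inv_one_add_add_sq_le _ _
  have hgi : Integrable (Function.uncurry fun u v : ℝ => f (u ^ 2 + v ^ 2)) :=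
    Integrable.mono' ((integrable_inv_one_add_sq.mul_prod integrable_inv_one_add_sq).const_mul C)
      hgc.aestronglyMeasurable (ae_of_all _ fun p => hgb p.1 p.2)
  have hfi : IntegrableOn f (Ioi 0) := (hF.integrable.comp_mul_right' hy.ne').integrableOn
  have hPF : ∀ p : ℤ × ℤ, planeFourier (fun u v => f (u ^ 2 + v ^ 2)) p.1 p.2 =
      (π / y : ℂ) * H (latticeNormSq p) := fun p => by
    rw [planeFourier_radial hfi hgi, ← latticeNormSq_cast]
    -- Rescaling x by y moves the dilation from F to the Bessel argument and produces the factor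
    -- 1/y.
    have e := integral_comp_mul_right_Ioi (fun x : ℝ =>
      (besselJZero (2 * π * √((latticeNormSq p : ℕ) * x / y)) : ℂ) * F x) 0 hy
    have hyc : (y : ℂ) ≠ 0 := by exact_mod_cast hy.ne'
    rw [zero_mul, Complex.real_smul] at e
    have e2 : ∀ x : ℝ, ((latticeNormSq p : ℕ) : ℝ) * (x * y) / y = (latticeNormSq p : ℕ) * x :=
      fun x => by field_simp
    simp only [e2] at e
    rw [hf, e, hH]
    push_cast
    field_simp
  have hPs : Summable fun p : ℤ × ℤ => planeFourier (fun u v => f (u ^ 2 + v ^ 2)) p.1 p.2 := by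
    simp only [hPF]
    exact hs2.mul_left _
  have key := tsum_tsum_int_eq_tsum_planeFourier hgc hgb hPs
  simp only [hPF] at key
  rw [tsum_mul_left] at key
  rw [← key, hs1.tsum_prod]
  simp only [hf, latticeNormSq_cast]

/-- As J₀(0) = 1, the zero frequency of the dual sum is the main term. -/
theorem integral_besselJZero_zero_mul (F : ℝ → ℂ) (y : ℝ) :
    ∫ x in Ioi (0 : ℝ), (besselJZero (2 * π * √((0 : ℕ) * x / y)) : ℂ) * F x =
      ∫ x in Ioi (0 : ℝ), F x := by
  simp [besselJZero_zero]

/-- The Hardy–Landau formula. -/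
theorem circle_formula (hF : IsEvenHalfLineSchwartz F) {y : ℝ} (hy : 0 < y) :
    Summable (fun n : ℕ => (sumTwoSquaresCount (n + 1) : ℂ) *
      ∫ x in Ioi (0 : ℝ), (besselJZero (2 * π * √((n + 1 : ℕ) * x / y)) : ℂ) * F x) ∧
    ∑' n : ℕ, (sumTwoSquaresCount n : ℂ) * F (n * y) =
      (π / y : ℂ) * (∫ x in Ioi (0 : ℝ), F x) +
        (π / y : ℂ) * ∑' n : ℕ, (sumTwoSquaresCount (n + 1) : ℂ) *
          ∫ x in Ioi (0 : ℝ), (besselJZero (2 * π * √((n + 1 : ℕ) * x / y)) : ℂ) * F x := by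
  obtain ⟨_, h2, h3⟩ := hF.tsum_sumTwoSquaresCount_mul hy
  refine ⟨(summable_nat_add_iff 1).2 h2, ?_⟩
  rw [h3, h2.tsum_eq_zero_add, integral_besselJZero_zero_mul, sumTwoSquaresCount_zero,
    Nat.cast_one, one_mul, mul_add]

end IsEvenHalfLineSchwartz

theorem mainTheorem7 (F : ℝ → ℂ) (hF : IsEvenHalfLineSchwartz F) :
    -- the integral of `F` and the Fourier transform of `F` are absolutely convergent
    Integrable F ∧
    -- the circle formula in sine form
    (∀ y : ℝ, 0 < y →
      Summable (fun n : ℕ => (sumTwoSquaresCount n : ℂ) * F (n * y)) ∧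
      ∃ S : ℕ → ℂ,
        (∀ n : ℕ, 1 ≤ n → HasImproperIntegralAtZero
          (fun u : ℝ => (Real.sin (π ^ 2 * n / (y * u)) : ℂ) * fourierHat F u / (u : ℂ)) (S n)) ∧
        Summable (fun n : ℕ => (sumTwoSquaresCount (n + 1) : ℂ) * S (n + 1)) ∧
        ∑' n : ℕ, (sumTwoSquaresCount n : ℂ) * F (n * y) =
          (π / y : ℂ) * (∫ u in Ioi (0 : ℝ), F u) +
            (1 / y : ℂ) * ∑' n : ℕ, (sumTwoSquaresCount (n + 1) : ℂ) * S (n + 1)) ∧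
    -- the Plancherel identity for the sine kernel and `J₀`
    (∀ α : ℝ, 0 < α →
      IntegrableOn (fun x : ℝ => (besselJZero (2 * √(α * x)) : ℂ) * F x) (Ioi 0) ∧
      HasImproperIntegralAtZero
        (fun u : ℝ => (Real.sin (α / u) : ℂ) * fourierHat F u / (u : ℂ))
        ((π : ℂ) * ∫ x in Ioi (0 : ℝ), (besselJZero (2 * √(α * x)) : ℂ) * F x)) ∧
    -- the classical circle formula, at scale `y` (the usual form is `y = 1`)
    (∀ y : ℝ, 0 < y →
      Summable (fun n : ℕ => (sumTwoSquaresCount (n + 1) : ℂ) *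
        ∫ x in Ioi (0 : ℝ), (besselJZero (2 * π * √((n + 1 : ℕ) * x / y)) : ℂ) * F x) ∧
      F 0 + ∑' n : ℕ, (sumTwoSquaresCount (n + 1) : ℂ) * F ((n + 1 : ℕ) * y) =
        (π / y : ℂ) * (∫ x in Ioi (0 : ℝ), F x) +
          (π / y : ℂ) * ∑' n : ℕ, (sumTwoSquaresCount (n + 1) : ℂ) *
            ∫ x in Ioi (0 : ℝ), (besselJZero (2 * π * √((n + 1 : ℕ) * x / y)) : ℂ) * F x) := by
  have hscale : ∀ (y : ℝ) (n : ℕ) (x : ℝ), 2 * √(π ^ 2 * n / y * x) = 2 * π * √(n * x / y) :=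
    fun y n x => by
      rw [show π ^ 2 * n / y * x = π ^ 2 * (n * x / y) by ring, sqrt_mul (sq_nonneg π),
        sqrt_sq pi_pos.le, mul_assoc]
  refine ⟨hF.integrable, fun y hy => ?_, fun α hα => ⟨?_, ?_⟩, fun y hy => ?_⟩
  · obtain ⟨hs, _, _⟩ := hF.tsum_sumTwoSquaresCount_mul hy
    obtain ⟨hs', he⟩ := hF.circle_formula hy
    -- The values of the sine integrals are dictated by the Plancherel identity at α = π²n/y.
    refine ⟨hs, fun n => π *
      ∫ x in Ioi (0 : ℝ), (besselJZero (2 * π * √(n * x / y)) : ℂ) * F x, fun n hn => ?_, ?_, ?_⟩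
    · have hn0 : (0 : ℝ) < n := by exact_mod_cast hn
      have h := hF.hasImproperIntegralAtZero_sin_mul_fourierHat
        (α := π ^ 2 * n / y) (by positivity)
      simpa only [hscale, div_div] using h
    · refine (hs'.mul_left (π : ℂ)).congr fun n => ?_
      ring
    · rw [he]
      have e : ∀ n : ℕ, (sumTwoSquaresCount (n + 1) : ℂ) * (π *
          ∫ x in Ioi (0 : ℝ), (besselJZero (2 * π * √((n + 1 : ℕ) * x / y)) : ℂ) * F x) =
          π * ((sumTwoSquaresCount (n + 1) : ℂ) *
            ∫ x in Ioi (0 : ℝ), (besselJZero (2 * π * √((n + 1 : ℕ) * x / y)) : ℂ) * F x) :=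
        fun n => by ring
      simp only [e]
      rw [tsum_mul_left]
      ring
  · exact hF.integrableOn_besselJZero_mul (g := fun x => 2 * √(α * x)) (by fun_prop)
  · exact hF.hasImproperIntegralAtZero_sin_mul_fourierHat hα
  · obtain ⟨hs, _, _⟩ := hF.tsum_sumTwoSquaresCount_mul hy
    obtain ⟨hs', he⟩ := hF.circle_formula hy
    refine ⟨hs', ?_⟩
    rw [← he, hs.tsum_eq_zero_add, sumTwoSquaresCount_zero]
    simp
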